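/- Let $\mathbf k$ be an algebraically closed field of arbitrary characteristic $p\ge 0$, and let $V$ be a $\mathbf k$-vector space of odd finite dimension $2N+1$ with a nondegenerate quadratic form $Q$. Put $\beta(v,w)=Q(v+w)-Q(v)-Q(w)$ and $\mathrm{Rad}(Q)=\{v\in V:\beta(v,V)=0\}$. A quadratic form on a finite-dimensional space is called nondegenerate if the radical of its associated bilinear form contains no nonzero vector on which the form vanishes (over $\mathbf k$ that radical then has dimension at most $1$). Let $G=SO(V)$ be the identity component of $O(V)$, that is, the group of isometries of $Q$ of determinant $1$. Its Lie algebra is $\mathfrak g=\{x\in\mathrm{End}(V):\beta(xv,v)=0\ \forall v\in V,\ x|_{\mathrm{Rad}(Q)}=0\}$. For $\xi\in\mathfrak g^*$ let $Z_G(\xi)$ be its stabilizer for the coadjoint action. Choose $X\in \mathrm{End}(V)$ with $\xi(x)=\mathrm{tr}(Xx)$ for all $x\in\mathfrak g$, and let $\beta_\xi$ be the alternating bilinear form $\beta_\xi(v,w)=\beta(Xv,w)-\beta(v,Xw)$ on $V$ (it does not depend on the choice of $X$). Fix an $o$-good grading $V=\bigoplus_{a\in\mathbb Z}V^a$. This means: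 $\dim V^a=\dim V^{-a}\ge\dim V^{-a-2}$ for all $a\ge 0$; $\dim V^a$ is even for all odd $a$; $\beta(V^a,V^b)=0$ if $a+b\ne 0$; $Q|_{V^a}=0$ if $a\neq 0$. Let $\delta:\mathbf k^*\to G$ be given by $\delta(r)|_{V^a}=r^a$. Put $\mathfrak g_i=\{x\in\mathfrak g:\delta(r)x\delta(r)^{-1}=r^ix\ \forall r\in\mathbf k^*\}$ and $\mathfrak g^{*\delta}_2=\mathrm{Ann}\big(\bigoplus_{i\ne -2}\mathfrak g_i\big)\subset\mathfrak g^*$. With $V^{\ge a}=\bigoplus_{b\ge a}V^b$, let $G^\delta_{\ge 0}=\{g\in G: gV^{\ge a}=V^{\ge a}\ \forall a\}$; this is the closed connected subgroup of $G$ with Lie algebra $\bigoplus_{i\ge 0}\mathfrak g_i$. Put $$\mathfrak g_2^{*\delta!}=\{\xi\in\mathfrak g_2^{*\delta}: Z_G(\xi)\subset G_{\ge 0}^\delta\}.$$ Let $\mathfrak S(V)_2$ be the set of alternating bilinear forms $\eta$ on $V$ with $\eta(V^a,V^b)=0$ whenever $a+b\neq -2$. For $\eta\in\mathfrak S(V)_2$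 and $a\ne -2$ let $A:V^a\to V^{a+2}$ be the unique linear map with $\beta(Ax,y)=\eta(x,y)$ for all $x\in V^a$, $y\in V^{-a-2}$. Let $\mathfrak S(V)_2^0$ be the set of $\eta\in\mathfrak S(V)_2$ such that (a) all maps in $V^0\xrightarrow{A}V^2\xrightarrow{A}V^4\xrightarrow{A}\cdots$ are surjective, and the restriction of $Q$ to $\ker(A^n:V^0\to V^{2n})$ is nondegenerate for all $n\ge 1$; (b) all maps in $V^{-1}\xrightarrow{A}V^1\xrightarrow{A}V^3\xrightarrow{A}\cdots$ are surjective, and the form $(x,y)\mapsto\beta(Ax,y)$ on $\ker(A^n:V^{-1}\to V^{2n-1})$ is nondegenerate for all $n\ge 1$. Then for every $\xi\in\mathfrak g^*$: $\ \xi\in\mathfrak g_2^{*\delta!}$ if and only if $\beta_\xi\in\mathfrak S(V)_2^0$. -/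

import Mathlib

open QuadraticMap
open scoped TensorProduct

noncomputable section

namespace OddOrthogonal

variable {k : Type*} [Field k] {V : Type*} [AddCommGroup V] [Module k V]

/-! Throughout, `β(v, w) = Q(v + w) - Q(v) - Q(w)` is `Q.polarBilin v w` and
`Rad(Q) = {v | β(v, V) = 0}` is `Q.polarBilin.ker`. -/

/-! ### The group, its Lie algebra, and the coadjoint action -/

/-- The special orthogonal group. It is only used for `dim V` odd; there the identity component
of `O(V)` is the subgroup of isometries of determinant `1`, in every characteristic. -/
def SO (Q : QuadraticForm k V) : Subgroup (V ≃ₗ[k] V) where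
  carrier := {g | (∀ v, Q (g v) = Q v) ∧ LinearMap.det (g : V →ₗ[k] V) = 1}
  one_mem' := ⟨fun _ => rfl, LinearMap.det_id⟩
  mul_mem' := by
    rintro g h ⟨hg, hg'⟩ ⟨hh, hh'⟩
    refine ⟨fun v => (hg (h v)).trans (hh v), ?_⟩
    have : ((g * h : V ≃ₗ[k] V) : V →ₗ[k] V) = (g : V →ₗ[k] V) * (h : V →ₗ[k] V) := rfl
    rw [this, map_mul, hg', hh', one_mul]
  inv_mem' := by
    rintro g ⟨hg, hg'⟩
    refine ⟨fun v => ?_, ?_⟩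
    · have h := hg (g⁻¹ v)
      rw [← h]
      exact congrArg Q (g.apply_symm_apply v)
    · have h1 := LinearEquiv.det_mul_det_symm g
      rw [hg', one_mul] at h1
      exact h1

/-- The Lie algebra `𝔤 = 𝔬(V)`: the endomorphisms `x` with `β(xv, v) = 0` for all `v` and
`x = 0` on `Rad(Q)`. -/
def orthLie (Q : QuadraticForm k V) : Submodule k (Module.End k V) where
  carrier := {x | (∀ v, Q.polarBilin (x v) v = 0) ∧ ∀ v ∈ Q.polarBilin.ker, x v = 0}
  zero_mem' := by simp
  add_mem' := by
    rintro x y ⟨hx, hx'⟩ ⟨hy, hy'⟩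
    refine ⟨fun v => ?_, fun v hv => ?_⟩
    · rw [LinearMap.add_apply, map_add, LinearMap.add_apply, hx, hy, add_zero]
    · rw [LinearMap.add_apply, hx' v hv, hy' v hv, add_zero]
  smul_mem' := by
    rintro c x ⟨hx, hx'⟩
    refine ⟨fun v => ?_, fun v hv => ?_⟩
    · rw [LinearMap.smul_apply, map_smul, LinearMap.smul_apply, hx, smul_zero]
    · rw [LinearMap.smul_apply, hx' v hv, smul_zero]

theorem polarBilin_map {Q : QuadraticForm k V} {g : V ≃ₗ[k] V} (hg : ∀ v, Q (g v) = Q v)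
    (v w : V) : Q.polarBilin (g v) (g w) = Q.polarBilin v w := by
  simp only [polarBilin_apply_apply, polar, ← map_add, hg]

theorem conj_mem_orthLie {Q : QuadraticForm k V} {g : V ≃ₗ[k] V} (hg : g ∈ SO Q)
    {x : Module.End k V} (hx : x ∈ orthLie Q) : g.conj x ∈ orthLie Q := by
  refine ⟨fun v => ?_, fun v hv => ?_⟩
  · have h := hx.1 (g.symm v)
    rw [← polarBilin_map hg.1, g.apply_symm_apply] at h
    exact h
  · have h : g.symm v ∈ Q.polarBilin.ker := by
      rw [LinearMap.mem_ker]
      ext w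
      rw [← polarBilin_map hg.1, g.apply_symm_apply, LinearMap.mem_ker.1 hv]
      rfl
    have h2 := hx.2 _ h
    rw [LinearEquiv.conj_apply_apply, h2, map_zero]

/-- The adjoint representation `Ad(g) x = g x g⁻¹` of `G = SO(V)` on `𝔤`. -/
def Ad (Q : QuadraticForm k V) : Representation k (SO Q) (orthLie Q) where
  toFun g := (g : V ≃ₗ[k] V).conj.toLinearMap.restrict fun _ hx => conj_mem_orthLie g.2 hx
  map_one' := by ext; rfl
  map_mul' _ _ := by ext; rfl

/-- The centralizer `Z_G(ξ)` of `ξ ∈ 𝔤*` in `G` under the coadjoint action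
`(g · ξ)(x) = ξ(Ad(g⁻¹) x)`. -/
def coadjointCentralizer (Q : QuadraticForm k V) (ξ : Module.Dual k (orthLie Q)) :
    Subgroup (SO Q) where
  carrier := {g | (Ad Q).dual g ξ = ξ}
  one_mem' := by simp only [Set.mem_ofPred_eq, map_one]; rfl
  mul_mem' := by
    intro g h hg hh
    simp only [Set.mem_ofPred_eq] at hg hh ⊢
    rw [map_mul, Module.End.mul_apply, hh, hg]
  inv_mem' := by
    intro g hg
    simp only [Set.mem_ofPred_eq] at hg ⊢
    conv_lhs => rw [← hg]
    rw [← Module.End.mul_apply, ← map_mul, inv_mul_cancel, map_one]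
    rfl

/-! ### `o`-good gradings and the gradings of `𝔤` and `𝔤*` -/

/-- A grading `V = ⨁ V^a` is `o`-good. (That `V` is the direct sum of the `V^a` is recorded
by the instance `DirectSum.Decomposition`.) -/
structure IsOGood (Q : QuadraticForm k V) (𝒱 : ℤ → Submodule k V)
    [DirectSum.Decomposition 𝒱] : Prop where
  finrank_neg : ∀ a : ℤ, 0 ≤ a → Module.finrank k (𝒱 a) = Module.finrank k (𝒱 (-a))
  finrank_le : ∀ a : ℤ, 0 ≤ a → Module.finrank k (𝒱 (-a - 2)) ≤ Module.finrank k (𝒱 (-a))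
  even_finrank : ∀ a : ℤ, Odd a → Even (Module.finrank k (𝒱 a))
  orthogonal : ∀ a b : ℤ, a + b ≠ 0 → ∀ x ∈ 𝒱 a, ∀ y ∈ 𝒱 b, Q.polarBilin x y = 0
  isotropic : ∀ a : ℤ, a ≠ 0 → ∀ x ∈ 𝒱 a, Q x = 0

/-- The one-parameter subgroup `δ : k* → GL(V)` attached to a grading: `δ(r)` is multiplication
by `r ^ a` on `V^a`. -/
def cocharacter (𝒱 : ℤ → Submodule k V) [DirectSum.Decomposition 𝒱] : kˣ →* (V ≃ₗ[k] V) where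
  toFun r := (DirectSum.decomposeLinearEquiv 𝒱).trans
    ((DFinsupp.mapRange.linearEquiv fun a : ℤ =>
      (LinearEquiv.smulOfUnit (r ^ a) : 𝒱 a ≃ₗ[k] 𝒱 a)).trans
      (DirectSum.decomposeLinearEquiv 𝒱).symm)
  map_one' := by
    ext v
    rw [LinearEquiv.trans_apply, LinearEquiv.trans_apply, LinearEquiv.symm_apply_eq]
    refine DFinsupp.ext fun a => ?_
    rw [DFinsupp.mapRange.linearEquiv_apply, DFinsupp.mapRange_apply, one_zpow]
    exact one_smul kˣ _
  map_mul' r s := by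
    ext v
    rw [LinearEquiv.mul_apply]
    simp only [LinearEquiv.trans_apply, LinearEquiv.apply_symm_apply]
    congr 1
    refine DFinsupp.ext fun a => ?_
    simp only [mul_zpow]
    exact mul_smul (r ^ a) (s ^ a) _

theorem cocharacter_apply (𝒱 : ℤ → Submodule k V) [DirectSum.Decomposition 𝒱] (r : kˣ) {a : ℤ}
    {v : V} (hv : v ∈ 𝒱 a) : cocharacter 𝒱 r v = (r ^ a : kˣ) • v := by
  change (DirectSum.decomposeLinearEquiv 𝒱).symm _ = _
  rw [LinearEquiv.symm_apply_eq]
  lift v to 𝒱 a using hv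
  refine DFinsupp.ext fun b => Subtype.ext ?_
  have h1 : DirectSum.decomposeLinearEquiv 𝒱 ((r ^ a : kˣ) • (v : V)) =
      (r ^ a : kˣ) • DirectSum.decomposeLinearEquiv 𝒱 (v : V) :=
    map_smul (DirectSum.decomposeLinearEquiv 𝒱) ((r ^ a : kˣ) : k) (v : V)
  rw [h1]
  change ((r ^ b : kˣ) • (DirectSum.decompose 𝒱 (v : V) b) : 𝒱 b).1 =
    ((r ^ a : kˣ) • DirectSum.decompose 𝒱 (v : V) b : 𝒱 b).1
  by_cases hb : b = a
  · rw [hb]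
  · have h0 : DirectSum.decompose 𝒱 (v : V) b = 0 :=
      Subtype.ext (DirectSum.decompose_of_mem_ne 𝒱 v.2 (Ne.symm hb))
    rw [h0, smul_zero, smul_zero]

/-- `𝔤_i = {x ∈ 𝔤 | δ(r) x δ(r)⁻¹ = r ^ i x for all r ∈ k*}`. -/
def gradedPiece (Q : QuadraticForm k V) (𝒱 : ℤ → Submodule k V) [DirectSum.Decomposition 𝒱]
    (i : ℤ) : Submodule k (orthLie Q) where
  carrier := {x | ∀ r : kˣ, (cocharacter 𝒱 r).conj (x : Module.End k V) =
    (r ^ i : kˣ) • (x : Module.End k V)}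
  zero_mem' := by simp
  add_mem' := by
    intro x y hx hy r
    rw [Submodule.coe_add, map_add, hx r, hy r, smul_add]
  smul_mem' := by
    intro c x hx r
    rw [Submodule.coe_smul, map_smul, hx r, smul_comm]

/-- `𝔤*_j = Ann(⨁_{i ≠ -j} 𝔤_i)`. -/
def dualGradedPiece (Q : QuadraticForm k V) (𝒱 : ℤ → Submodule k V) [DirectSum.Decomposition 𝒱]
    (j : ℤ) : Submodule k (Module.Dual k (orthLie Q)) :=
  (⨆ i : ℤ, ⨆ _ : i ≠ -j, gradedPiece Q 𝒱 i).dualAnnihilator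

/-- `V^{≥ a} = ⨁_{b ≥ a} V^b`. -/
def filtration (𝒱 : ℤ → Submodule k V) (a : ℤ) : Submodule k V :=
  ⨆ b : ℤ, ⨆ _ : a ≤ b, 𝒱 b

/-- The parabolic subgroup `G_{≥ 0}` of `G = SO(V)` attached to the grading (the closed connected
subgroup with Lie algebra `⨁_{i ≥ 0} 𝔤_i`): the stabilizer in `G` of the filtration
`(V^{≥ a})`. -/
def parabolic (Q : QuadraticForm k V) (𝒱 : ℤ → Submodule k V) : Subgroup (SO Q) where
  carrier := {g | ∀ a, (filtration 𝒱 a).map ((g : V ≃ₗ[k] V) : V →ₗ[k] V) = filtration 𝒱 a}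
  one_mem' := fun a => Submodule.map_id _
  mul_mem' := by
    intro g h hg hh a
    have : (((g * h : SO Q) : V ≃ₗ[k] V) : V →ₗ[k] V) =
      ((g : V ≃ₗ[k] V) : V →ₗ[k] V) ∘ₗ ((h : V ≃ₗ[k] V) : V →ₗ[k] V) := rfl
    rw [this, Submodule.map_comp, hh a, hg a]
  inv_mem' := by
    intro g hg a
    conv_lhs => rw [← hg a]
    rw [← Submodule.map_comp]
    convert Submodule.map_id _
    ext v
    exact (g : V ≃ₗ[k] V).symm_apply_apply v

/-- `𝔤_2^{*δ!}`: the `ξ ∈ 𝔤*_2` with `Z_G(ξ) ⊆ G_{≥ 0}`. -/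
def dualTwoShriek (Q : QuadraticForm k V) (𝒱 : ℤ → Submodule k V) [DirectSum.Decomposition 𝒱] :
    Set (Module.Dual k (orthLie Q)) :=
  {ξ | ξ ∈ dualGradedPiece Q 𝒱 2 ∧ coadjointCentralizer Q ξ ≤ parabolic Q 𝒱}

/-! ### The alternating form attached to `ξ` -/

/-- The bilinear form `(v, w) ↦ β(Xv, w) - β(v, Xw)`. -/
def formOfEnd (Q : QuadraticForm k V) (X : Module.End k V) : LinearMap.BilinForm k V :=
  LinearMap.BilinForm.compLeft Q.polarBilin X - LinearMap.BilinForm.compRight Q.polarBilin X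

theorem formOfEnd_apply (Q : QuadraticForm k V) (X : Module.End k V) (v w : V) :
    formOfEnd Q X v w = Q.polarBilin (X v) w - Q.polarBilin v (X w) := rfl

theorem trace_comp_smulRight [FiniteDimensional k V] (X : Module.End k V) (φ : Module.Dual k V)
    (v : V) : LinearMap.trace k V (X * φ.smulRight v) = φ (X v) := by
  have h : X * φ.smulRight v = dualTensorHom k V V (φ ⊗ₜ[k] X v) := by
    ext w
    simp
  rw [h, LinearMap.trace_eq_contract_apply, contractLeft_apply]

/-- Every linear form on `𝔤` is `x ↦ tr(Xx)` for some endomorphism `X` of `V`. -/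
theorem exists_trace_eq [FiniteDimensional k V] (Q : QuadraticForm k V)
    (ξ : Module.Dual k (orthLie Q)) :
    ∃ X : Module.End k V, ∀ x : orthLie Q, ξ x = LinearMap.trace k V (X * (x : Module.End k V)) := by
  obtain ⟨ξ', hξ'⟩ := LinearMap.exists_extend ξ
  let T : Module.End k V →ₗ[k] Module.Dual k (Module.End k V) :=
    (LinearMap.mul k (Module.End k V)).compr₂ (LinearMap.trace k V)
  have hT : Function.Injective T := by
    rw [injective_iff_map_eq_zero]
    intro X hX
    ext v
    refine (Module.forall_dual_apply_eq_zero_iff k _).1 fun φ => ?_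
    rw [← trace_comp_smulRight]
    exact LinearMap.congr_fun hX _
  have hT' : Function.Surjective T :=
    (LinearMap.injective_iff_surjective_of_finrank_eq_finrank
      Subspace.dual_finrank_eq.symm).1 hT
  obtain ⟨X, hX⟩ := hT' ξ'
  refine ⟨X, fun x => ?_⟩
  rw [← hξ']
  exact (LinearMap.congr_fun hX _).symm

/-- The form `β_ξ(v, w) = β(Xv, w) - β(v, Xw)`, where `X` is any endomorphism of `V` such that
`ξ(x) = tr(Xx)` for all `x ∈ 𝔤`; see `formOfDual_eq` for the independence of `X`. -/
def formOfDual [FiniteDimensional k V] (Q : QuadraticForm k V) (ξ : Module.Dual k (orthLie Q)) :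
    LinearMap.BilinForm k V :=
  formOfEnd Q (exists_trace_eq Q ξ).choose

theorem formOfDual_eq [FiniteDimensional k V] (Q : QuadraticForm k V)
    (ξ : Module.Dual k (orthLie Q)) (X : Module.End k V)
    (hX : ∀ x : orthLie Q, ξ x = LinearMap.trace k V (X * (x : Module.End k V))) :
    formOfDual Q ξ = formOfEnd Q X := by
  ext v w
  have hs : ∀ a b : V, Q.polarBilin a b = Q.polarBilin b a := fun a b => polar_comm Q a b
  have hmem : (Q.polarBilin w).smulRight v - (Q.polarBilin v).smulRight w ∈ orthLie Q := by
    refine ⟨fun u => ?_, fun u hu => ?_⟩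
    · simp only [LinearMap.sub_apply, LinearMap.smulRight_apply, map_sub, map_smul]
      change Q.polarBilin w u * Q.polarBilin v u - Q.polarBilin v u * Q.polarBilin w u = 0
      ring
    · rw [LinearMap.mem_ker] at hu
      rw [LinearMap.sub_apply, LinearMap.smulRight_apply, LinearMap.smulRight_apply, hs w, hs v, hu]
      simp
  have key : ∀ Y : Module.End k V,
      (∀ x : orthLie Q, ξ x = LinearMap.trace k V (Y * (x : Module.End k V))) →
      formOfEnd Q Y v w = ξ ⟨_, hmem⟩ := by
    intro Y hY
    rw [hY, mul_sub, map_sub, trace_comp_smulRight, trace_comp_smulRight, formOfEnd_apply,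
      hs (Y v) w]
  rw [key X hX]
  exact key _ (exists_trace_eq Q ξ).choose_spec

/-! ### The sets `𝔖(V)_2` and `𝔖(V)_2^0` -/

/-- `𝔖(V)_2`: the symplectic (that is, alternating) bilinear forms `η` on `V` with
`η(V^a, V^b) = 0` whenever `a + b ≠ -2`. -/
def formsTwo (𝒱 : ℤ → Submodule k V) : Set (LinearMap.BilinForm k V) :=
  {η | η.IsAlt ∧ ∀ a b : ℤ, a + b ≠ -2 → ∀ x ∈ 𝒱 a, ∀ y ∈ 𝒱 b, η x y = 0}

/-- `A` collects the maps `A : V^a → V^{a+2}`, `a ≠ -2`, determined by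
`β(Ax, y) = η(x, y)` for `x ∈ V^a`, `y ∈ V^{-a-2}`, into one endomorphism of `V`. On `V^{-2}`,
where no map is defined, it is given the value `0`, which is never used. -/
structure IsRaisingMap (Q : QuadraticForm k V) (𝒱 : ℤ → Submodule k V)
    (η : LinearMap.BilinForm k V) (A : Module.End k V) : Prop where
  map_mem : ∀ a : ℤ, a ≠ -2 → ∀ x ∈ 𝒱 a, A x ∈ 𝒱 (a + 2)
  form_eq : ∀ a : ℤ, a ≠ -2 → ∀ x ∈ 𝒱 a, ∀ y ∈ 𝒱 (-a - 2), Q.polarBilin (A x) y = η x y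
  map_neg_two : ∀ x ∈ 𝒱 (-2), A x = 0

/-- The maps `A` exist and are unique. -/
theorem existsUnique_isRaisingMap [FiniteDimensional k V] {Q : QuadraticForm k V}
    (hQ : Q.Nondegenerate) {𝒱 : ℤ → Submodule k V} [DirectSum.Decomposition 𝒱]
    (h𝒱 : IsOGood Q 𝒱) (η : LinearMap.BilinForm k V) : ∃! A, IsRaisingMap Q 𝒱 η A := by
  -- `β` pairs `V^b` and `V^{-b}` perfectly for `b ≠ 0`
  have hsep : ∀ b : ℤ, b ≠ 0 → ∀ y ∈ 𝒱 b, (∀ z ∈ 𝒱 (-b), Q.polarBilin y z = 0) → y = 0 := by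
    intro b hb y hy h
    have h0 : ∀ z, Q.polarBilin y z = 0 := by
      intro z
      induction z using DirectSum.Decomposition.inductionOn 𝒱 with
      | zero => simp
      | @homogeneous c z =>
        by_cases hc : b + c = 0
        · obtain rfl : c = -b := by omega
          exact h _ z.2
        · exact h𝒱.orthogonal b c hc y hy _ z.2
      | add z z' hz hz' => rw [map_add, hz, hz', add_zero]
    have hr : y ∈ Q.radical := ⟨h𝒱.isotropic b hb y hy, LinearMap.ext h0⟩
    rwa [hQ.radical_eq_bot, Submodule.mem_bot] at hr
  have hdim : ∀ b : ℤ, Module.finrank k (𝒱 b) = Module.finrank k (𝒱 (-b)) := by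
    intro b
    rcases le_total 0 b with hb | hb
    · exact h𝒱.finrank_neg b hb
    · have := h𝒱.finrank_neg (-b) (by omega)
      rw [neg_neg] at this
      exact this.symm
  have hperf : ∀ b : ℤ, b ≠ 0 → ∀ φ : Module.Dual k (𝒱 (-b)),
      ∃ y ∈ 𝒱 b, ∀ z : 𝒱 (-b), Q.polarBilin y z = φ z := by
    intro b hb φ
    let P : 𝒱 b →ₗ[k] Module.Dual k (𝒱 (-b)) :=
      Q.polarBilin.compl₁₂ (𝒱 b).subtype (𝒱 (-b)).subtype
    have hP : Function.Injective P := by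
      rw [injective_iff_map_eq_zero]
      intro y hy
      exact Subtype.ext (hsep b hb y y.2 fun z hz => LinearMap.congr_fun hy ⟨z, hz⟩)
    obtain ⟨y, hy⟩ := (LinearMap.injective_iff_surjective_of_finrank_eq_finrank
      ((hdim b).trans Subspace.dual_finrank_eq.symm)).1 hP φ
    exact ⟨y, y.2, fun z => LinearMap.congr_fun hy z⟩
  have hex : ∀ a : ℤ, ∃ f : 𝒱 a →ₗ[k] V, (a = -2 → f = 0) ∧
      (a ≠ -2 → ∀ x, f x ∈ 𝒱 (a + 2) ∧ ∀ z ∈ 𝒱 (-(a + 2)), Q.polarBilin (f x) z = η x z) := by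
    intro a
    by_cases ha : a = -2
    · exact ⟨0, fun _ => rfl, fun h => absurd ha h⟩
    · have hb : a + 2 ≠ 0 := by omega
      have h1 : ∀ x : 𝒱 a, ∃ y ∈ 𝒱 (a + 2), ∀ z : 𝒱 (-(a + 2)), Q.polarBilin y z = η x z :=
        fun x => hperf _ hb ((η x).comp (𝒱 (-(a + 2))).subtype)
      choose f hf hf' using h1
      have huniq : ∀ y ∈ 𝒱 (a + 2), ∀ y' ∈ 𝒱 (a + 2),
          (∀ z ∈ 𝒱 (-(a + 2)), Q.polarBilin y z = Q.polarBilin y' z) → y = y' := by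
        intro y hy y' hy' h
        refine sub_eq_zero.1 (hsep _ hb _ (sub_mem hy hy') fun z hz => ?_)
        rw [map_sub, LinearMap.sub_apply, h z hz, sub_self]
      refine ⟨⟨⟨f, fun x x' => ?_⟩, fun c x => ?_⟩, fun h => absurd h ha, fun _ x =>
        ⟨hf x, fun z hz => hf' x ⟨z, hz⟩⟩⟩
      · refine huniq _ (hf _) _ (add_mem (hf _) (hf _)) fun z hz => ?_
        rw [hf' _ ⟨z, hz⟩, map_add, LinearMap.add_apply, hf' _ ⟨z, hz⟩, hf' _ ⟨z, hz⟩]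
        simp
      · refine huniq _ (hf _) _ (Submodule.smul_mem _ _ (hf _)) fun z hz => ?_
        rw [hf' _ ⟨z, hz⟩, map_smul, LinearMap.smul_apply]
        simp only [RingHom.id_apply]
        rw [hf' _ ⟨z, hz⟩]
        simp
  choose f hf0 hf using hex
  let A : Module.End k V :=
    (DirectSum.toModule k ℤ V f) ∘ₗ (DirectSum.decomposeLinearEquiv 𝒱).toLinearMap
  have hA : ∀ (a : ℤ) (x : 𝒱 a), A x = f a x := by
    intro a x
    change DirectSum.toModule k ℤ V f (DirectSum.decompose 𝒱 (x : V)) = _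
    rw [DirectSum.decompose_coe]
    exact DirectSum.toModule_lof (M := fun i => 𝒱 i) k a x
  have hneg : ∀ a : ℤ, -a - 2 = -(a + 2) := fun a => by ring
  refine ⟨A, ⟨fun a ha x hx => ?_, fun a ha x hx y hy => ?_, fun x hx => ?_⟩, fun B hB => ?_⟩
  · rw [hA a ⟨x, hx⟩]
    exact (hf a ha _).1
  · rw [hA a ⟨x, hx⟩]
    rw [hneg] at hy
    exact (hf a ha _).2 y hy
  · rw [hA (-2) ⟨x, hx⟩, hf0 _ rfl]
    rfl
  · ext x
    induction x using DirectSum.Decomposition.inductionOn 𝒱 with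
    | zero => simp
    | @homogeneous a x =>
      rw [hA]
      by_cases ha : a = -2
      · subst ha
        rw [hB.map_neg_two _ x.2, hf0 _ rfl]
        rfl
      · refine sub_eq_zero.1 (hsep (a + 2) (by omega) _
          (sub_mem (hB.map_mem a ha _ x.2) (hf a ha x).1) fun z hz => ?_)
        rw [map_sub, LinearMap.sub_apply, (hf a ha x).2 z hz,
          hB.form_eq a ha _ x.2 z (by rwa [hneg]), sub_self]
    | add z z' hz hz' => rw [map_add, hz, hz', map_add]

/-- `𝔖(V)_2^0`. Nondegeneracy of the quadratic form `Q` on a subspace `K` means that the radical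
of `β` on `K` has dimension at most `1` and contains no nonzero zero of `Q`. -/
def formsTwoZero (Q : QuadraticForm k V) (𝒱 : ℤ → Submodule k V) :
    Set (LinearMap.BilinForm k V) :=
  {η | η ∈ formsTwo 𝒱 ∧ ∃ A : Module.End k V, IsRaisingMap Q 𝒱 η A ∧
    -- the chain `V^0 → V^2 → V^4 → ⋯`
    (∀ n : ℕ, (𝒱 (2 * n)).map A = 𝒱 (2 * n + 2)) ∧
    (∀ n : ℕ, 1 ≤ n → (Q.comp (𝒱 0 ⊓ (A ^ n).ker).subtype).Nondegenerate) ∧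
    -- the chain `V^{-1} → V^1 → V^3 → ⋯`
    (∀ n : ℕ, (𝒱 (2 * n - 1)).map A = 𝒱 (2 * n + 1)) ∧
    (∀ n : ℕ, 1 ≤ n →
      (LinearMap.BilinForm.restrict (LinearMap.BilinForm.compLeft Q.polarBilin A)
        (𝒱 (-1) ⊓ (A ^ n).ker)).Nondegenerate)}

end OddOrthogonal

end

noncomputable section

namespace OddOrthogonal

variable {k : Type*} [Field k] {V : Type*} [AddCommGroup V] [Module k V]

/-! ### Homogeneous components -/

section Components

variable {𝒱 : ℤ → Submodule k V}

/-! The elements `v ∧ w` span `𝔤` (`orthLie_le_of_wedge_mem`), and `β_ξ(v, w) = ξ(v ∧ w)`. Hence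
`Z_G(ξ)` is the stabilizer of `η = β_ξ` in `G` (`mem_coadjointCentralizer_iff`), and `ξ` has degree
2 exactly when `η` lies in `𝔖(V)_2` (`mem_dualGradedPiece_two_iff`). It remains to see, for such an
`η`, that its stabilizer preserves the filtration `V^{≥ a}` if and only if (a) and (b) hold.

The basic tool is the link `η(x, ·) = β(y, ·)`. It replaces `y = Ax`, is preserved by every isometry
fixing `η`, and still makes sense from `V^{-2}` to `V^0`, where `A` is undefined because `β` may be
degenerate on `V^0`. Sequences of links are called chains.

Sufficiency (`map_filtration_eq_of_mem_formsTwoZero`) is a downward induction on `M ≥ 1`. If `V^{≥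
M+1}` is stable, so is its orthogonal `V^{≥ -M}`. Under (a) and (b) a vector of `V^M` normally ends
a chain of `M` links starting in `V^{-M}`. Its image under `g` starts in `V^{≥ -M}`, each link
raises the degree by 2, and so the image ends in `V^{≥ M}` (`mem_filtration_of_chain`). This fails
only if `M = 2l` and some `r` in `Rad(Q)` has `A^l r ≠ 0`; `map_mem_filtration_of_pow_ne_zero` then
bounds `g V^{≥ 2l}` by orthogonality relations.

Necessity (`mem_formsTwoZero_of_stabilizer`): each failure of (a) or (b) yields a unipotent isometry
fixing `η` and lowering a degree. Failure of surjectivity from `V^a`, `a ≥ 0`, gives a Siegel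
transformation (`homComponent_siegel_eq_zero`); a degenerate kernel gives `1 + N` with `N` an
alternating sum of wedges along chains (`homComponent_sum_wedge_eq_zero`). On `V^{-1}` the latter
needs two independent radical vectors, and evenness of the odd-degree dimensions excludes a
one-dimensional radical. -/

theorem mem_filtration_of_mem {a b : ℤ} (hab : a ≤ b) {v : V} (hv : v ∈ 𝒱 b) :
    v ∈ filtration 𝒱 a :=
  Submodule.mem_iSup_of_mem b (Submodule.mem_iSup_of_mem hab hv)

theorem filtration_le {a : ℤ} {p : Submodule k V} (h : ∀ b, a ≤ b → 𝒱 b ≤ p) :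
    filtration 𝒱 a ≤ p :=
  iSup_le fun b => iSup_le fun hb => h b hb

theorem filtration_anti {a b : ℤ} (hab : a ≤ b) : filtration 𝒱 b ≤ filtration 𝒱 a :=
  filtration_le fun _ hc _ hx => mem_filtration_of_mem (hab.trans hc) hx

variable (𝒱) [DirectSum.Decomposition 𝒱]

/-- The projection of `V` onto its homogeneous component `V^b`. -/
def homComponent (b : ℤ) : V →ₗ[k] V :=
  (𝒱 b).subtype ∘ₗ DirectSum.component k ℤ (fun i => 𝒱 i) b ∘ₗ
    (DirectSum.decomposeLinearEquiv 𝒱).toLinearMap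

theorem homComponent_apply (b : ℤ) (v : V) :
    homComponent 𝒱 b v = (DirectSum.decompose 𝒱 v b : V) := rfl

theorem homComponent_mem (b : ℤ) (v : V) : homComponent 𝒱 b v ∈ 𝒱 b :=
  (DirectSum.decompose 𝒱 v b).2

variable {𝒱}

theorem homComponent_same {b : ℤ} {v : V} (hv : v ∈ 𝒱 b) : homComponent 𝒱 b v = v :=
  DirectSum.decompose_of_mem_same 𝒱 hv

theorem homComponent_ne {a b : ℤ} (hab : a ≠ b) {v : V} (hv : v ∈ 𝒱 a) :
    homComponent 𝒱 b v = 0 :=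
  DirectSum.decompose_of_mem_ne 𝒱 hv hab

theorem eq_of_homComponent {v w : V} (h : ∀ b, homComponent 𝒱 b v = homComponent 𝒱 b w) :
    v = w :=
  (DirectSum.decompose 𝒱).injective (DFinsupp.ext fun b => Subtype.ext (h b))

theorem mem_of_homComponent {v : V} {a : ℤ} (h : ∀ b, b ≠ a → homComponent 𝒱 b v = 0) :
    v ∈ 𝒱 a := by
  have : v = homComponent 𝒱 a v := by
    refine eq_of_homComponent (𝒱 := 𝒱) fun b => ?_
    by_cases hb : b = a
    · subst hb
      rw [homComponent_same (homComponent_mem 𝒱 b v)]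
    · rw [h b hb, homComponent_ne (Ne.symm hb) (homComponent_mem 𝒱 a v)]
  rw [this]
  exact homComponent_mem 𝒱 a v

theorem linearMap_ext_of_homogeneous {W : Type*} [AddCommGroup W] [Module k W]
    (f g : V →ₗ[k] W) (h : ∀ a, ∀ x ∈ 𝒱 a, f x = g x) : f = g := by
  ext z
  induction z using DirectSum.Decomposition.inductionOn 𝒱 with
  | zero => simp
  | @homogeneous c z => exact h c _ z.2
  | add z z' hz hz' => rw [map_add, hz, hz', map_add]

theorem mem_filtration_iff {a : ℤ} {v : V} :
    v ∈ filtration 𝒱 a ↔ ∀ b < a, homComponent 𝒱 b v = 0 := by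
  classical
  constructor
  · intro hv b hb
    have : filtration 𝒱 a ≤ LinearMap.ker (homComponent 𝒱 b) :=
      filtration_le fun c hc x hx => homComponent_ne (by omega) hx
    exact this hv
  · intro h
    rw [← DirectSum.sum_support_decompose 𝒱 v]
    refine Submodule.sum_mem _ fun b hb => ?_
    by_cases hba : b < a
    · have := h b hba
      rw [homComponent_apply] at this
      rw [this]
      exact zero_mem _
    · exact mem_filtration_of_mem (not_lt.1 hba) (DirectSum.decompose 𝒱 v b).2

theorem sub_homComponent_mem_filtration {a : ℤ} {v : V} (hv : v ∈ filtration 𝒱 a) :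
    v - homComponent 𝒱 a v ∈ filtration 𝒱 (a + 1) := by
  rw [mem_filtration_iff] at hv ⊢
  intro b hb
  rw [map_sub]
  by_cases h : b = a
  · subst h
    rw [homComponent_same (homComponent_mem 𝒱 b v), sub_self]
  · rw [hv b (by omega), homComponent_ne (Ne.symm h) (homComponent_mem 𝒱 a v), sub_zero]

theorem exists_filtration_eq_bot [FiniteDimensional k V] :
    ∃ M : ℕ, filtration 𝒱 (M : ℤ) = ⊥ := by
  classical
  have hfin : {i | 𝒱 i ≠ ⊥}.Finite :=
    WellFoundedGT.finite_ne_bot_of_iSupIndep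
      (DirectSum.Decomposition.isInternal 𝒱).submodule_iSupIndep
  obtain ⟨B, hB⟩ := hfin.bddAbove
  refine ⟨(B + 1).toNat, ?_⟩
  rw [eq_bot_iff]
  refine filtration_le fun b hb => ?_
  by_contra hne
  have h1 : b ∈ {i | 𝒱 i ≠ ⊥} := fun h => hne (h ▸ le_rfl)
  have := hB h1
  omega

end Components

/-! ### Orthogonality relations -/

section Orthogonality

variable {Q : QuadraticForm k V} {𝒱 : ℤ → Submodule k V} [DirectSum.Decomposition 𝒱]

theorem polarBilin_symm (Q : QuadraticForm k V) (v w : V) :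
    Q.polarBilin v w = Q.polarBilin w v := polar_comm Q v w

theorem map_add_polarBilin (Q : QuadraticForm k V) (v w : V) :
    Q (v + w) = Q v + Q w + Q.polarBilin v w :=
  QuadraticMap.map_add Q v w

theorem polarBilin_eq_homComponent (h𝒱 : IsOGood Q 𝒱) {a : ℤ} {v : V} (hv : v ∈ 𝒱 a) (w : V) :
    Q.polarBilin v w = Q.polarBilin v (homComponent 𝒱 (-a) w) := by
  refine LinearMap.congr_fun (linearMap_ext_of_homogeneous (𝒱 := 𝒱) (Q.polarBilin v)
    (Q.polarBilin v ∘ₗ homComponent 𝒱 (-a)) fun b x hx => ?_) w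
  rw [LinearMap.comp_apply]
  by_cases hb : b = -a
  · subst hb
    rw [homComponent_same hx]
  · rw [homComponent_ne hb hx, map_zero]
    exact h𝒱.orthogonal a b (by omega) v hv x hx

theorem form_eq_homComponent {η : LinearMap.BilinForm k V} (hη : η ∈ formsTwo 𝒱) {a : ℤ} {v : V}
    (hv : v ∈ 𝒱 a) (w : V) : η v w = η v (homComponent 𝒱 (-a - 2) w) := by
  refine LinearMap.congr_fun (linearMap_ext_of_homogeneous (𝒱 := 𝒱) (η v)
    (η v ∘ₗ homComponent 𝒱 (-a - 2)) fun b x hx => ?_) w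
  rw [LinearMap.comp_apply]
  by_cases hb : b = -a - 2
  · subst hb
    rw [homComponent_same hx]
  · rw [homComponent_ne hb hx, map_zero]
    exact hη.2 a b (by omega) v hv x hx

theorem polarBilin_eq_zero_of_mem (h𝒱 : IsOGood Q 𝒱) {a : ℤ} {y : V} (hy : y ∈ 𝒱 a)
    (h : ∀ z ∈ 𝒱 (-a), Q.polarBilin y z = 0) : Q.polarBilin y = 0 := by
  ext z
  rw [polarBilin_eq_homComponent h𝒱 hy]
  exact h _ (homComponent_mem 𝒱 _ z)

theorem eq_zero_of_mem_ker (hQ : Q.Nondegenerate) {y : V} (hy : Q y = 0)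
    (h : Q.polarBilin y = 0) : y = 0 := by
  have hr : y ∈ Q.radical := ⟨hy, h⟩
  rwa [hQ.radical_eq_bot, Submodule.mem_bot] at hr

theorem eq_zero_of_polarBilin (hQ : Q.Nondegenerate) (h𝒱 : IsOGood Q 𝒱) {a : ℤ} (ha : a ≠ 0)
    {y : V} (hy : y ∈ 𝒱 a) (h : ∀ z ∈ 𝒱 (-a), Q.polarBilin y z = 0) : y = 0 :=
  eq_zero_of_mem_ker hQ (h𝒱.isotropic a ha y hy) (polarBilin_eq_zero_of_mem h𝒱 hy h)

theorem finrank_neg_eq (h𝒱 : IsOGood Q 𝒱) (b : ℤ) :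
    Module.finrank k (𝒱 b) = Module.finrank k (𝒱 (-b)) := by
  rcases le_total 0 b with hb | hb
  · exact h𝒱.finrank_neg b hb
  · have := h𝒱.finrank_neg (-b) (by omega)
    rw [neg_neg] at this
    exact this.symm

/-- A vector of `V^{-b}` orthogonal to `V^b` lies in `Rad(Q)` and is singular, hence zero; equality
of dimensions makes the pairing perfect. Degree 0 must be left out, since `Rad(Q)` sits there. -/
theorem exists_polarBilin_eq [FiniteDimensional k V] (hQ : Q.Nondegenerate) (h𝒱 : IsOGood Q 𝒱)
    {b : ℤ} (hb : b ≠ 0) (φ : Module.Dual k V) :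
    ∃ y ∈ 𝒱 (-b), ∀ z ∈ 𝒱 b, Q.polarBilin y z = φ z := by
  let P : 𝒱 (-b) →ₗ[k] Module.Dual k (𝒱 b) :=
    Q.polarBilin.compl₁₂ (𝒱 (-b)).subtype (𝒱 b).subtype
  have hP : Function.Injective P := by
    rw [injective_iff_map_eq_zero]
    intro y hy
    refine Subtype.ext (eq_zero_of_polarBilin hQ h𝒱 (by omega) y.2 fun z hz => ?_)
    rw [neg_neg] at hz
    exact LinearMap.congr_fun hy ⟨z, hz⟩
  obtain ⟨y, hy⟩ := (LinearMap.injective_iff_surjective_of_finrank_eq_finrank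
    ((finrank_neg_eq h𝒱 b).symm.trans Subspace.dual_finrank_eq.symm)).1 hP (φ ∘ₗ (𝒱 b).subtype)
  exact ⟨y, y.2, fun z hz => LinearMap.congr_fun hy ⟨z, hz⟩⟩

theorem polarBilin_filtration (h𝒱 : IsOGood Q 𝒱) {a b : ℤ} (hab : 0 < a + b) {v w : V}
    (hv : v ∈ filtration 𝒱 a) (hw : w ∈ filtration 𝒱 b) : Q.polarBilin v w = 0 := by
  have h1 : filtration 𝒱 a ≤ LinearMap.ker (Q.polarBilin.flip w) := by
    refine filtration_le fun c hc x hx => ?_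
    rw [LinearMap.mem_ker, LinearMap.flip_apply, polarBilin_eq_homComponent h𝒱 hx,
      mem_filtration_iff.1 hw (-c) (by omega), map_zero]
  exact h1 hv

theorem form_filtration {η : LinearMap.BilinForm k V} (hη : η ∈ formsTwo 𝒱) {a b : ℤ}
    (hab : -2 < a + b) {v w : V} (hv : v ∈ filtration 𝒱 a) (hw : w ∈ filtration 𝒱 b) :
    η v w = 0 := by
  have h1 : filtration 𝒱 a ≤ LinearMap.ker (η.flip w) := by
    refine filtration_le fun c hc x hx => ?_
    change η x w = 0
    rw [form_eq_homComponent hη hx,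
      mem_filtration_iff.1 hw (-c - 2) (by omega), map_zero]
  exact h1 hv

theorem quadraticForm_filtration_one (h𝒱 : IsOGood Q 𝒱) {v : V} (hv : v ∈ filtration 𝒱 1) :
    Q v = 0 := by
  classical
  rw [← DirectSum.sum_support_decompose 𝒱 v]
  have key : ∀ s : Finset ℤ, Q (∑ i ∈ s, (DirectSum.decompose 𝒱 v i : V)) = 0 ∧
      (∑ i ∈ s, (DirectSum.decompose 𝒱 v i : V)) ∈ filtration 𝒱 1 := by
    intro s
    induction s using Finset.induction_on with
    | empty => simp
    | insert i s his ih =>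
      have hi : (DirectSum.decompose 𝒱 v i : V) ∈ filtration 𝒱 1 ∧
          Q (DirectSum.decompose 𝒱 v i : V) = 0 := by
        by_cases h : i < 1
        · have h0 := mem_filtration_iff.1 hv i h
          rw [homComponent_apply] at h0
          rw [h0]
          exact ⟨zero_mem _, QuadraticMap.map_zero Q⟩
        · exact ⟨mem_filtration_of_mem (not_lt.1 h) (DirectSum.decompose 𝒱 v i).2,
            h𝒱.isotropic i (by omega) _ (DirectSum.decompose 𝒱 v i).2⟩
      rw [Finset.sum_insert his]
      refine ⟨?_, add_mem hi.1 ih.2⟩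
      rw [map_add_polarBilin, hi.2, ih.1, polarBilin_filtration h𝒱 (by norm_num) hi.1 ih.2]
      simp
  exact (key _).1

theorem quadraticForm_filtration_zero (h𝒱 : IsOGood Q 𝒱) {v : V} (hv : v ∈ filtration 𝒱 0) :
    Q v = Q (homComponent 𝒱 0 v) := by
  have h1 := sub_homComponent_mem_filtration hv
  have h2 : homComponent 𝒱 0 v ∈ filtration 𝒱 0 :=
    mem_filtration_of_mem le_rfl (homComponent_mem 𝒱 0 v)
  conv_lhs => rw [← add_sub_cancel (homComponent 𝒱 0 v) v]
  rw [map_add_polarBilin, quadraticForm_filtration_one h𝒱 h1,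
    polarBilin_filtration h𝒱 (by norm_num) h2 h1, add_zero, add_zero]

/-- With `M ≥ 0` only degrees below `-M`, hence nonzero ones, have to be detected, and there the
pairing is perfect. This transfers stability from `V^{≥ M+1}` to `V^{≥ -M}`. -/
theorem mem_filtration_iff_orthogonal (hQ : Q.Nondegenerate) (h𝒱 : IsOGood Q 𝒱) {M : ℤ}
    (hM : 0 ≤ M) {v : V} :
    v ∈ filtration 𝒱 (-M) ↔ ∀ w ∈ filtration 𝒱 (M + 1), Q.polarBilin v w = 0 := by
  refine ⟨fun hv w hw => polarBilin_filtration h𝒱 (by omega) hv hw, fun h => ?_⟩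
  rw [mem_filtration_iff]
  intro b hb
  refine eq_zero_of_polarBilin hQ h𝒱 (by omega) (homComponent_mem 𝒱 b v) fun z hz => ?_
  have h1 := h z (mem_filtration_of_mem (by omega) hz)
  rw [polarBilin_symm, polarBilin_eq_homComponent h𝒱 hz, neg_neg, polarBilin_symm] at h1
  exact h1

end Orthogonality

/-! ### Raising maps and chains -/

section Raising

variable {Q : QuadraticForm k V} {𝒱 : ℤ → Submodule k V}
  {η : LinearMap.BilinForm k V} {A : Module.End k V}

theorem form_swap (hη : η.IsAlt) (x y : V) : η x y = -η y x :=
  (LinearMap.BilinForm.IsAlt.neg_eq hη y x).symm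

theorem IsRaisingMap.pow_mem (hA : IsRaisingMap Q 𝒱 η A) {a : ℤ} {n : ℕ}
    (ha : ∀ i : ℕ, i < n → a + 2 * i ≠ -2) {x : V} (hx : x ∈ 𝒱 a) :
    (A ^ n) x ∈ 𝒱 (a + 2 * n) := by
  induction n with
  | zero => simpa using hx
  | succ n ih =>
    rw [pow_succ', Module.End.mul_apply]
    have := hA.map_mem _ (ha n n.lt_succ_self) _ (ih fun i hi => ha i (by omega))
    convert this using 2
    push_cast
    ring

variable [DirectSum.Decomposition 𝒱]

theorem IsRaisingMap.polarBilin_eq (hA : IsRaisingMap Q 𝒱 η A) (h𝒱 : IsOGood Q 𝒱)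
    (hη : η ∈ formsTwo 𝒱) {a : ℤ} (ha : a ≠ -2) {x : V} (hx : x ∈ 𝒱 a) :
    η x = Q.polarBilin (A x) := by
  ext z
  rw [form_eq_homComponent hη hx, polarBilin_eq_homComponent h𝒱 (hA.map_mem a ha x hx)]
  have e : -(a + 2) = -a - 2 := by ring
  rw [e]
  exact (hA.form_eq a ha x hx _ (homComponent_mem 𝒱 _ z)).symm

/-- Each link is moved from the chain to `z` as an application of `A`, and alternation of `η` costs
a sign. Only the degrees of `z` must avoid `-2`, so the chain itself may cross from `V^{-2}` to
`V^0`. -/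
theorem polarBilin_chain (hA : IsRaisingMap Q 𝒱 η A) (h𝒱 : IsOGood Q 𝒱)
    (hη : η ∈ formsTwo 𝒱) {y : ℕ → V} {n : ℕ}
    (hy : ∀ i < n, η (y i) = Q.polarBilin (y (i + 1))) {c : ℤ}
    (hc : ∀ i : ℕ, i < n → c + 2 * i ≠ -2) {z : V} (hz : z ∈ 𝒱 c) :
    Q.polarBilin (y n) z = (-1) ^ n * Q.polarBilin ((A ^ n) z) (y 0) := by
  induction n generalizing c z with
  | zero => simp [polar_comm]
  | succ n ih =>
    have h0 : c ≠ -2 := by simpa using hc 0 n.succ_pos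
    rw [← hy n n.lt_succ_self, form_swap hη.1, hA.polarBilin_eq h𝒱 hη h0 hz, polarBilin_symm,
      ih (fun i hi => hy i (by omega)) (c := c + 2) (fun i hi => ?_) (hA.map_mem c h0 z hz),
      pow_succ A, Module.End.mul_apply]
    · ring
    · have := hc (i + 1) (by omega)
      push_cast at this
      omega

/-- A functional killing `ker A^n` factors through `A^n`, and on `V^{c+2n}`, a nonzero degree, every
functional comes from `β`. -/
theorem exists_polarBilin_pow_eq [FiniteDimensional k V] (hA : IsRaisingMap Q 𝒱 η A)
    (hQ : Q.Nondegenerate) (h𝒱 : IsOGood Q 𝒱) {c : ℤ} {n : ℕ}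
    (hc : ∀ i : ℕ, i < n → c + 2 * i ≠ -2) (hcn : c + 2 * n ≠ 0) (φ : Module.Dual k V)
    (hφ : ∀ z ∈ 𝒱 c, (A ^ n) z = 0 → φ z = 0) :
    ∃ x ∈ 𝒱 (-(c + 2 * n)), ∀ z ∈ 𝒱 c, φ z = Q.polarBilin ((A ^ n) z) x := by
  let f : 𝒱 c →ₗ[k] V := (A ^ n) ∘ₗ (𝒱 c).subtype
  have h1 : φ ∘ₗ (𝒱 c).subtype ∈ (LinearMap.ker f).dualAnnihilator := by
    rw [Submodule.mem_dualAnnihilator]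
    intro z hz
    exact hφ z z.2 hz
  rw [← LinearMap.range_dualMap_eq_dualAnnihilator_ker] at h1
  obtain ⟨g, hg⟩ := h1
  obtain ⟨x, hx, hx'⟩ := exists_polarBilin_eq hQ h𝒱 hcn g
  refine ⟨x, hx, fun z hz => ?_⟩
  rw [polarBilin_symm, hx' _ (hA.pow_mem hc hz)]
  exact (LinearMap.congr_fun hg ⟨z, hz⟩).symm

/-- Orthogonality of `u` to `ker A^n` on `V^0` is what allows a chain through `u` to be continued
backwards to `V^{-2n}`: since `β(u, ·)` factors through `A^n`, a starting vector can be read off by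
duality. -/
theorem exists_chain_of_mem_zero [FiniteDimensional k V] (hA : IsRaisingMap Q 𝒱 η A)
    (hQ : Q.Nondegenerate) (h𝒱 : IsOGood Q 𝒱) (hη : η ∈ formsTwo 𝒱) {n : ℕ} (hn : 1 ≤ n)
    {u : V} (hu : u ∈ 𝒱 0) (hu' : ∀ z ∈ 𝒱 0, (A ^ n) z = 0 → Q.polarBilin u z = 0) :
    ∃ y : ℕ → V, y n = u ∧ (∀ i, y (n + i) = (A ^ i) u) ∧
      (∀ i : ℕ, y i ∈ 𝒱 (2 * i - 2 * n)) ∧ ∀ i, η (y i) = Q.polarBilin (y (i + 1)) := by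
  obtain ⟨x, hx, hx'⟩ := exists_polarBilin_pow_eq hA hQ h𝒱 (c := 0) (n := n)
    (fun i _ => by omega) (by omega) (Q.polarBilin u) hu'
  -- The sign cancels the one that `polarBilin_chain` and one more swap of `η` produce in the middle
  -- link.
  set x' : V := ((-1 : k) ^ n) • x with hx'def
  have hx'mem : x' ∈ 𝒱 (-(2 * n)) := by
    rw [zero_add] at hx
    exact Submodule.smul_mem _ _ hx
  have hlow : ∀ i : ℕ, i < n → (A ^ i) x' ∈ 𝒱 (2 * i - 2 * n) := fun i hi => by
    have := hA.pow_mem (n := i) (fun j hj => by omega) hx'mem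
    convert this using 2
    ring
  have hhigh : ∀ i : ℕ, (A ^ i) u ∈ 𝒱 (2 * i) := fun i => by
    have := hA.pow_mem (n := i) (fun j hj => by omega) hu
    rwa [zero_add] at this
  have hlink : ∀ i : ℕ, i + 1 < n → η ((A ^ i) x') = Q.polarBilin ((A ^ (i + 1)) x') := by
    intro i hi
    rw [hA.polarBilin_eq h𝒱 hη (by omega) (hlow i (by omega)), pow_succ', Module.End.mul_apply]
  obtain ⟨m, rfl⟩ : ∃ m, n = m + 1 := ⟨n - 1, by omega⟩
  refine ⟨fun i => if i < m + 1 then (A ^ i) x' else (A ^ (i - (m + 1))) u, ?_, ?_, ?_, ?_⟩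
  · simp
  · intro i
    dsimp only
    rw [if_neg (by omega), Nat.add_sub_cancel_left]
  · intro i
    dsimp only
    split_ifs with h
    · exact hlow i h
    · convert hhigh (i - (m + 1)) using 2
      push_cast [Nat.cast_sub (not_lt.1 h)]
      ring
  · intro i
    dsimp only
    rcases lt_trichotomy i m with h | rfl | h
    · rw [if_pos (by omega), if_pos (by omega)]
      exact hlink i (by omega)
    -- The link from `V^{-2}` to `V^0`, which `A` does not provide: moved over to `z ∈ V^0`, it
    -- becomes the defining property of `x`.
    · rw [if_pos (by omega), if_neg (by omega), Nat.sub_self, pow_zero, Module.End.one_apply]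
      ext z
      have hm := hlow i (by omega)
      rw [form_eq_homComponent hη hm, polarBilin_eq_homComponent h𝒱 hu]
      have e : -(2 * (i : ℤ) - 2 * ((i + 1 : ℕ) : ℤ)) - 2 = -0 := by push_cast; ring
      rw [e]
      have hz : homComponent 𝒱 (-0) z ∈ 𝒱 0 := by
        rw [neg_zero]; exact homComponent_mem 𝒱 0 z
      generalize homComponent 𝒱 (-0) z = z at hz
      have hz1 : A z ∈ 𝒱 2 := by simpa using hA.map_mem 0 (by norm_num) z hz
      have h3 := polarBilin_chain hA h𝒱 hη (y := fun j => (A ^ j) x') (n := i)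
        (fun j hj => hlink j (by omega)) (c := 2) (fun j hj => by omega) hz1
      rw [form_swap hη.1, hA.polarBilin_eq h𝒱 hη (by norm_num) hz, polarBilin_symm, h3, hx' z hz,
        pow_zero, Module.End.one_apply, hx'def, map_smul, pow_succ A, Module.End.mul_apply,
        smul_eq_mul, pow_succ]
      have hs : ((-1 : k) ^ i) * (-1) ^ i = 1 := by rw [← mul_pow]; simp
      linear_combination (Q.polarBilin ((A ^ i) (A z)) x) * hs
    · rw [if_neg (by omega), if_neg (by omega)]
      obtain ⟨j, rfl⟩ : ∃ j, i = m + 1 + j := ⟨i - (m + 1), by omega⟩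
      have e1 : m + 1 + j - (m + 1) = j := by omega
      have e2 : m + 1 + j + 1 - (m + 1) = j + 1 := by omega
      rw [e1, e2, hA.polarBilin_eq h𝒱 hη (by omega) (hhigh j), pow_succ', Module.End.mul_apply]

/-- Odd degrees never meet `-2`, so the iterates of `A` always form a chain. -/
theorem odd_chain (hA : IsRaisingMap Q 𝒱 η A) (h𝒱 : IsOGood Q 𝒱) (hη : η ∈ formsTwo 𝒱)
    {c : ℤ} (hc : Odd c) {x : V} (hx : x ∈ 𝒱 c) (i : ℕ) :
    (A ^ i) x ∈ 𝒱 (c + 2 * i) ∧ η ((A ^ i) x) = Q.polarBilin ((A ^ (i + 1)) x) := by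
  obtain ⟨d, rfl⟩ := hc
  have h := hA.pow_mem (n := i) (fun j hj => by omega) hx
  exact ⟨h, by rw [hA.polarBilin_eq h𝒱 hη (by omega) h, pow_succ', Module.End.mul_apply]⟩

/-- The odd analogue of `exists_chain_of_mem_zero`. Since `V^{-1}` and `V^1` are in perfect duality,
the chain reaches `u` itself by powers of `A`. -/
theorem exists_pow_eq_of_mem_neg_one [FiniteDimensional k V] (hA : IsRaisingMap Q 𝒱 η A)
    (hQ : Q.Nondegenerate) (h𝒱 : IsOGood Q 𝒱) (hη : η ∈ formsTwo 𝒱) {n : ℕ}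
    {u : V} (hu : u ∈ 𝒱 (-1)) (hu' : ∀ z ∈ 𝒱 1, (A ^ n) z = 0 → Q.polarBilin u z = 0) :
    ∃ x ∈ 𝒱 (-(1 + 2 * n)), (A ^ n) x = u := by
  obtain ⟨x, hx, hx'⟩ := exists_polarBilin_pow_eq hA hQ h𝒱 (c := 1) (n := n)
    (fun i _ => by omega) (by omega) (Q.polarBilin u) hu'
  set x' : V := ((-1 : k) ^ n) • x with hx'def
  have hx'mem : x' ∈ 𝒱 (-(1 + 2 * n)) := Submodule.smul_mem _ _ hx
  refine ⟨x', hx'mem, ?_⟩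
  have hc := odd_chain hA h𝒱 hη (by simp [parity_simps]) hx'mem
  have hm := (hc n).1
  have e : -(1 + 2 * (n : ℤ)) + 2 * n = -1 := by ring
  rw [e] at hm
  refine sub_eq_zero.1 (eq_zero_of_polarBilin hQ h𝒱 (a := -1) (by norm_num) (sub_mem hm hu)
    fun z hz => ?_)
  rw [neg_neg] at hz
  have h3 := polarBilin_chain hA h𝒱 hη (y := fun j => (A ^ j) x') (n := n)
        (fun j hj => (hc j).2) (c := 1) (fun j hj => by omega) hz
  rw [map_sub, LinearMap.sub_apply, h3, hx' z hz, pow_zero, Module.End.one_apply, hx'def, map_smul,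
    smul_eq_mul]
  have hs : ((-1 : k) ^ n) * (-1) ^ n = 1 := by rw [← mul_pow]; simp
  linear_combination (Q.polarBilin ((A ^ n) z) x) * hs

end Raising

/-! ### Linear algebra of bilinear and quadratic forms -/

section LinearAlgebra

theorem exists_eq_smul_of_ker_le {f g : Module.Dual k V} (h : ∀ x, f x = 0 → g x = 0) :
    ∃ c : k, g = c • f := by
  by_cases hf : f = 0
  · refine ⟨0, ?_⟩
    ext x
    rw [h x (by rw [hf]; rfl)]
    simp
  · obtain ⟨x, hx⟩ : ∃ x, f x ≠ 0 := by
      by_contra! hcon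
      exact hf (LinearMap.ext hcon)
    refine ⟨g x / f x, ?_⟩
    ext z
    have h1 := h (f x • z - f z • x) (by simp [mul_comm])
    simp only [map_sub, map_smul, smul_eq_mul] at h1
    rw [LinearMap.smul_apply, smul_eq_mul]
    field_simp
    linear_combination h1

/-- By symmetry the range of `B` lies in the annihilator of its kernel, and the two have the same
dimension. -/
theorem exists_eq_of_vanish_on_ker [FiniteDimensional k V] (B : LinearMap.BilinForm k V)
    (hB : ∀ x y, B x y = B y x) (f : Module.Dual k V) (hf : ∀ x, B x = 0 → f x = 0) :
    ∃ u, B u = f := by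
  let D : V →ₗ[k] Module.Dual k V := B
  have hle : LinearMap.range D ≤ (LinearMap.ker D).dualAnnihilator := by
    rintro _ ⟨u, rfl⟩
    rw [Submodule.mem_dualAnnihilator]
    intro x hx
    change B u x = 0
    rw [hB]
    exact LinearMap.congr_fun hx u
  have h1 := LinearMap.finrank_range_add_finrank_ker D
  have h2 := Subspace.finrank_add_finrank_dualAnnihilator_eq (LinearMap.ker D)
  have h3 := Submodule.eq_of_le_of_finrank_eq hle (by omega)
  have h4 : f ∈ LinearMap.range D := by
    rw [h3, Submodule.mem_dualAnnihilator]
    exact fun x hx => hf x hx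
  exact h4

theorem exists_sub_orthogonal [FiniteDimensional k V] (B : LinearMap.BilinForm k V)
    (K : Submodule k V) (hK : ∀ x ∈ K, (∀ z ∈ K, B x z = 0) → x = 0) (v : V) :
    ∃ w ∈ K, ∀ z ∈ K, B (v - w) z = 0 := by
  let P : K →ₗ[k] Module.Dual k K := B.compl₁₂ K.subtype K.subtype
  have hP : Function.Injective P := by
    rw [injective_iff_map_eq_zero]
    exact fun y hy => Subtype.ext (hK y y.2 fun z hz => LinearMap.congr_fun hy ⟨z, hz⟩)
  obtain ⟨w, hw⟩ := (LinearMap.injective_iff_surjective_of_finrank_eq_finrank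
    Subspace.dual_finrank_eq.symm).1 hP (B v ∘ₗ K.subtype)
  refine ⟨w, w.2, fun z hz => ?_⟩
  have := LinearMap.congr_fun hw ⟨z, hz⟩
  rw [map_sub, LinearMap.sub_apply, sub_eq_zero]
  exact this.symm

/-- The rank of an alternating form is even: if `B x y ≠ 0`, pass to the orthogonal `P` of `x` and
`y`, which has codimension 2 and the same radical. -/
theorem even_finrank_add_finrank_ker (n : ℕ) : ∀ {W : Type*} [AddCommGroup W] [Module k W]
    [FiniteDimensional k W] (B : LinearMap.BilinForm k W), B.IsAlt → Module.finrank k W = n →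
    Even (Module.finrank k W + Module.finrank k (LinearMap.ker B)) := by
  induction n using Nat.strong_induction_on with
  | _ n ih =>
  intro W _ _ _ B hB hn
  by_cases h0 : B = 0
  · subst h0
    rw [LinearMap.ker_zero, finrank_top]
    exact Even.add_self _
  obtain ⟨x, y, hxy⟩ : ∃ x y, B x y ≠ 0 := by
    by_contra! hcon
    exact h0 (LinearMap.ext fun x => LinearMap.ext fun y => hcon x y)
  have hyx : B y x ≠ 0 := by rwa [form_swap hB, neg_ne_zero]
  let f : W →ₗ[k] k × k := (B x).prod (B y)
  have hf : Function.Surjective f := by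
    rintro ⟨a, b⟩
    refine ⟨(b / B y x) • x + (a / B x y) • y, ?_⟩
    ext
    · simp [f, hB.self_eq_zero, hxy]
    · simp [f, hB.self_eq_zero, hyx]
  set P := LinearMap.ker f with hPdef
  have hP : ∀ w, w ∈ P ↔ B x w = 0 ∧ B y w = 0 := fun w => by
    simp [hPdef, f]
  have hdim : Module.finrank k P + 2 = Module.finrank k W := by
    have h1 := LinearMap.finrank_range_add_finrank_ker f
    rw [LinearMap.range_eq_top.2 hf, finrank_top, Module.finrank_prod, Module.finrank_self,
      ← hPdef] at h1
    omega
  have hker : (LinearMap.ker (B.restrict P)).map P.subtype = LinearMap.ker B := by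
    ext w
    constructor
    · rintro ⟨p, hp, rfl⟩
      have hp1 : ∀ q : P, B p q = 0 := fun q => LinearMap.congr_fun hp q
      have hp2 := (hP _).1 p.2
      rw [LinearMap.mem_ker]
      ext z
      have hz : z - (B y z / B y x) • x - (B x z / B x y) • y ∈ P := by
        rw [hP]
        constructor
        · simp [hB.self_eq_zero, hxy]
        · simp [hB.self_eq_zero, hyx]
      have h3 := hp1 ⟨_, hz⟩
      simp only [map_sub, map_smul] at h3
      rw [form_swap hB (p : W) x, form_swap hB (p : W) y, hp2.1, hp2.2] at h3
      simpa using h3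
    · intro hw
      rw [LinearMap.mem_ker] at hw
      have hwP : w ∈ P := by
        rw [hP, form_swap hB, hw, form_swap hB y, hw]
        simp
      refine ⟨⟨w, hwP⟩, ?_, rfl⟩
      change B.restrict P ⟨w, hwP⟩ = 0
      ext q
      change B w q = 0
      rw [hw]
      rfl
  have hker' := Submodule.finrank_map_subtype_eq P (LinearMap.ker (B.restrict P))
  have := ih (Module.finrank k P) (by omega) (B.restrict P) (fun p => hB p) rfl
  rw [← hker, hker', ← hdim]
  have e : Module.finrank k P + 2 + Module.finrank k (LinearMap.ker (B.restrict P)) =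
    Module.finrank k P + Module.finrank k (LinearMap.ker (B.restrict P)) + 2 := by ring
  rw [e]
  exact this.add even_two

theorem polarBilin_self (Q : QuadraticForm k V) (x : V) : Q.polarBilin x x = 2 * Q x := by
  rw [polarBilin_apply_apply, polar_self, two_smul, two_mul]

/-- In characteristic 2 the form `β` is alternating, so its rank is even and odd dimension forces a
radical. -/
theorem exists_ne_zero_polarBilin_eq_zero [FiniteDimensional k V] (Q : QuadraticForm k V)
    (hV : Odd (Module.finrank k V)) (h2 : (2 : k) = 0) : ∃ r, r ≠ 0 ∧ Q.polarBilin r = 0 := by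
  have hB : LinearMap.BilinForm.IsAlt Q.polarBilin := fun x => by
    rw [polarBilin_self, h2, zero_mul]
  have h1 := even_finrank_add_finrank_ker _ Q.polarBilin hB rfl
  have h3 : LinearMap.ker Q.polarBilin ≠ ⊥ := by
    intro h
    rw [h, finrank_bot, add_zero] at h1
    exact (Nat.not_even_iff_odd.2 hV) h1
  obtain ⟨r, hr, hr0⟩ := Submodule.exists_mem_ne_zero_of_ne_bot h3
  exact ⟨r, hr0, hr⟩

theorem exists_quadraticForm_add_smul_eq_zero [IsAlgClosed k] (Q : QuadraticForm k V)
    (h2 : (2 : k) = 0) {x r : V} (hr : Q r ≠ 0) (hxr : Q.polarBilin x r = 0) :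
    ∃ c : k, Q (x + c • r) = 0 := by
  obtain ⟨c, hc⟩ := IsAlgClosed.exists_pow_nat_eq (Q x / Q r) (n := 2) two_pos
  refine ⟨c, ?_⟩
  rw [map_add_polarBilin, (Q.polarBilin x).map_smul, hxr, QuadraticMap.map_smul, ← pow_two, hc, smul_eq_mul,
    div_mul_cancel₀ _ hr, ← two_mul, h2]
  simp

/-- The bound on the radical of `β` is automatic over an algebraically closed field. In
characteristic 2, given radical vectors `r ≠ 0` and `v`, some `v + c r` is singular because `c` may
be a square root; hence it is zero. -/
theorem nondegenerate_of_radical_eq_bot [IsAlgClosed k] (Q : QuadraticForm k V)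
    (h : ∀ x, Q x = 0 → Q.polarBilin x = 0 → x = 0) : Q.Nondegenerate := by
  have hrad : Q.radical = ⊥ := by
    rw [eq_bot_iff]
    exact fun x hx => h x hx.1 hx.2
  by_cases h2 : (2 : k) = 0
  · refine ⟨hrad, ?_⟩
    rw [rank_le_one_iff]
    by_cases hker : ∀ r, Q.polarBilin r = 0 → r = 0
    · exact ⟨0, fun v => ⟨0, by rw [zero_smul]; exact (Subtype.ext (hker v v.2)).symm⟩⟩
    · push Not at hker
      obtain ⟨r, hr, hr0⟩ := hker
      refine ⟨⟨r, hr⟩, fun v => ?_⟩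
      obtain ⟨c, hc⟩ := exists_quadraticForm_add_smul_eq_zero Q h2 (x := (v : V)) (r := r)
        (fun h0 => hr0 (h r h0 hr)) (by rw [LinearMap.mem_ker.1 v.2]; rfl)
      have h1 := h _ hc (by rw [map_add, LinearMap.mem_ker.1 v.2, map_smul, hr]; simp)
      refine ⟨-c, Subtype.ext ?_⟩
      change (-c) • r = v
      rw [neg_smul, eq_comm, ← add_eq_zero_iff_eq_neg, h1]
  · let _ : Invertible (2 : k) := invertibleOfNonzero h2
    exact QuadraticMap.nondegenerate_iff_radical_eq_bot.2 hrad

theorem nondegenerate_comp_subtype_iff [IsAlgClosed k] (Q : QuadraticForm k V)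
    (K : Submodule k V) : (Q.comp K.subtype).Nondegenerate ↔
      ∀ x ∈ K, Q x = 0 → (∀ z ∈ K, Q.polarBilin x z = 0) → x = 0 := by
  have hpol : ∀ x z : K, (Q.comp K.subtype).polarBilin x z = Q.polarBilin (x : V) z := by
    intro x z
    simp [polar]
  constructor
  · intro h x hx h1 h2
    have := eq_zero_of_mem_ker h (y := ⟨x, hx⟩) h1 (LinearMap.ext fun z => by
      rw [hpol]; exact h2 z z.2)
    exact congrArg Subtype.val this
  · intro h
    refine nondegenerate_of_radical_eq_bot _ fun x h1 h2 => Subtype.ext (h x x.2 h1 fun z hz => ?_)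
    rw [← hpol x ⟨z, hz⟩, h2]
    rfl

/-- The point is that a vector `x` of `K` orthogonal to `K` is already in `Rad(Q)`. Outside
characteristic 2, `2 Q(x) = β(x, x) = 0` gives `x = 0`; in characteristic 2 a multiple of a radical
vector, which lies in `K` by `hker`, makes `x` singular. So `β(v, ·)` kills the radical of `β` on
`K` and is represented on `K`. -/
theorem exists_sub_orthogonal_of_ker_le [IsAlgClosed k] [FiniteDimensional k V]
    {Q : QuadraticForm k V} (hQ : Q.Nondegenerate) (hV : Odd (Module.finrank k V))
    (K : Submodule k V) (hK : ∀ x ∈ K, Q x = 0 → (∀ z ∈ K, Q.polarBilin x z = 0) → x = 0)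
    (hker : ∀ r, Q.polarBilin r = 0 → r ∈ K) (v : V) :
    ∃ w ∈ K, ∀ z ∈ K, Q.polarBilin (v - w) z = 0 := by
  have hrad : ∀ x ∈ K, (∀ z ∈ K, Q.polarBilin x z = 0) → Q.polarBilin x = 0 := by
    intro x hx h
    by_cases h2 : (2 : k) = 0
    · obtain ⟨r, hr0, hr⟩ := exists_ne_zero_polarBilin_eq_zero Q hV h2
      obtain ⟨c, hc⟩ := exists_quadraticForm_add_smul_eq_zero Q h2 (x := x) (r := r)
        (fun h0 => hr0 (eq_zero_of_mem_ker hQ h0 hr)) (h r (hker r hr))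
      have h1 := hK _ (add_mem hx (Submodule.smul_mem _ c (hker r hr))) hc (fun z hz => by
        rw [map_add, LinearMap.add_apply, h z hz, map_smul, hr]; simp)
      rw [← add_sub_cancel_right x (c • r), h1, map_sub, map_smul, hr]
      simp
    · have h1 := h x hx
      rw [polarBilin_self] at h1
      rw [hK x hx ((mul_eq_zero.1 h1).resolve_left h2) h, map_zero]
  let B : LinearMap.BilinForm k K := LinearMap.BilinForm.restrict Q.polarBilin K
  obtain ⟨w, hw⟩ := exists_eq_of_vanish_on_ker B (fun x y => polarBilin_symm Q x y)
    (Q.polarBilin v ∘ₗ K.subtype) (fun x hx => by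
      have := hrad x x.2 fun z hz => LinearMap.congr_fun hx ⟨z, hz⟩
      rw [LinearMap.comp_apply, polarBilin_symm]
      change Q.polarBilin (x : V) v = 0
      rw [this]
      rfl)
  refine ⟨w, w.2, fun z hz => ?_⟩
  have := LinearMap.congr_fun hw ⟨z, hz⟩
  rw [map_sub, LinearMap.sub_apply, sub_eq_zero]
  exact this.symm

end LinearAlgebra

/-! ### Recovering the filtration from `Q` and the form -/

section Recover

variable {Q : QuadraticForm k V} {𝒱 : ℤ → Submodule k V} {η : LinearMap.BilinForm k V}
  {A : Module.End k V}

variable {g : V ≃ₗ[k] V}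

theorem form_symm_map (hgη : ∀ v w, η (g v) (g w) = η v w) (v z : V) :
    η (g v) z = η v (g.symm z) := by
  rw [← hgη v, g.apply_symm_apply]

theorem polarBilin_symm_map (hgQ : ∀ v, Q (g v) = Q v) (v z : V) :
    Q.polarBilin (g v) z = Q.polarBilin v (g.symm z) := by
  rw [← polarBilin_map hgQ v, g.apply_symm_apply]

theorem link_map (hgQ : ∀ v, Q (g v) = Q v) (hgη : ∀ v w, η (g v) (g w) = η v w) {x y : V}
    (h : η x = Q.polarBilin y) : η (g x) = Q.polarBilin (g y) := by
  ext z
  rw [form_symm_map hgη, polarBilin_symm_map hgQ, h]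

/-- The starting points of chains of length `2 l` inside `V^{≥ -2l}` that are isotropic from the
middle on and end in `V^{> 2l}`. -/
def chainStart (Q : QuadraticForm k V) (𝒱 : ℤ → Submodule k V) (η : LinearMap.BilinForm k V)
    (l : ℕ) : Set V :=
  {x | ∃ y : ℕ → V, y 0 = x ∧ y 0 ∈ filtration 𝒱 (-(2 * l)) ∧
    (∀ i < 2 * l, η (y i) = Q.polarBilin (y (i + 1))) ∧
    (∀ i, l ≤ i → i ≤ 2 * l → Q (y i) = 0) ∧ y (2 * l) ∈ filtration 𝒱 (2 * l + 1)}

theorem map_mem_chainStart (hgQ : ∀ v, Q (g v) = Q v) (hgη : ∀ v w, η (g v) (g w) = η v w)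
    {l : ℕ} (hup : ∀ v ∈ filtration 𝒱 (2 * (l : ℤ) + 1), g v ∈ filtration 𝒱 (2 * (l : ℤ) + 1))
    (hlow : ∀ v ∈ filtration 𝒱 (-(2 * (l : ℤ))), g v ∈ filtration 𝒱 (-(2 * (l : ℤ))))
    {x : V} (hx : x ∈ chainStart Q 𝒱 η l) : g x ∈ chainStart Q 𝒱 η l := by
  obtain ⟨y, rfl, h0, h1, h2, h3⟩ := hx
  exact ⟨fun i => g (y i), rfl, hlow _ h0, fun i hi => link_map hgQ hgη (h1 i hi),
    fun i hi hi' => by rw [hgQ]; exact h2 i hi hi', hup _ h3⟩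

variable [DirectSum.Decomposition 𝒱]

theorem polarBilin_homComponent_left (h𝒱 : IsOGood Q 𝒱) {b : ℤ} {z : V} (hz : z ∈ 𝒱 (-b))
    (v : V) : Q.polarBilin (homComponent 𝒱 b v) z = Q.polarBilin v z := by
  rw [polarBilin_symm Q v, polarBilin_eq_homComponent h𝒱 hz, neg_neg, polarBilin_symm]

theorem form_homComponent_left (hη : η ∈ formsTwo 𝒱) {b : ℤ} {z : V} (hz : z ∈ 𝒱 (-b - 2))
    (v : V) : η (homComponent 𝒱 b v) z = η v z := by
  have e : -(-b - 2) - 2 = b := by ring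
  rw [form_swap hη.1 v, form_eq_homComponent hη hz, e, ← form_swap hη.1]

/-- A link is homogeneous of degree 2, because `η` pairs `V^{b-2}` and `β` pairs `V^b` with the same
space `V^{-b}`. -/
theorem link_homComponent (h𝒱 : IsOGood Q 𝒱) (hη : η ∈ formsTwo 𝒱) {x y : V}
    (h : η x = Q.polarBilin y) (b : ℤ) :
    η (homComponent 𝒱 (b - 2) x) = Q.polarBilin (homComponent 𝒱 b y) := by
  ext z
  have e : -(b - 2) - 2 = -b := by ring
  rw [form_eq_homComponent hη (homComponent_mem 𝒱 _ x),
    polarBilin_eq_homComponent h𝒱 (homComponent_mem 𝒱 _ y),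
    form_homComponent_left hη (homComponent_mem 𝒱 _ z), e,
    polarBilin_homComponent_left h𝒱 (homComponent_mem 𝒱 _ z), h]

theorem eq_zero_of_polarBilin_eq_zero (hQ : Q.Nondegenerate) (h𝒱 : IsOGood Q 𝒱) {a : ℤ}
    (ha : a ≠ 0) {y : V} (hy : y ∈ 𝒱 a) (h : Q.polarBilin y = 0) : y = 0 :=
  eq_zero_of_mem_ker hQ (h𝒱.isotropic a ha y hy) h

theorem mem_zero_of_polarBilin_eq_zero (hQ : Q.Nondegenerate) (h𝒱 : IsOGood Q 𝒱) {r : V}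
    (h : Q.polarBilin r = 0) : r ∈ 𝒱 0 :=
  mem_of_homComponent fun b hb => eq_zero_of_polarBilin hQ h𝒱 hb (homComponent_mem 𝒱 b r)
    fun z hz => by rw [polarBilin_homComponent_left h𝒱 hz, h]; rfl

theorem exists_eq_smul_of_polarBilin_eq_zero (hQ : Q.Nondegenerate) {r : V} (hr0 : r ≠ 0)
    (hr : Q.polarBilin r = 0) {v : V} (hv : Q.polarBilin v = 0) : ∃ c : k, v = c • r := by
  obtain ⟨r', hr'⟩ := (rank_le_one_iff).1 hQ.rank_rad_polar_le
  obtain ⟨a, ha⟩ := hr' ⟨r, hr⟩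
  obtain ⟨b, hb⟩ := hr' ⟨v, hv⟩
  have ha' : a • (r' : V) = r := congrArg Subtype.val ha
  have hb' : b • (r' : V) = v := congrArg Subtype.val hb
  have ha0 : a ≠ 0 := by
    rintro rfl
    rw [zero_smul] at ha'
    exact hr0 ha'.symm
  exact ⟨b / a, by rw [← ha', ← hb', smul_smul, div_mul_cancel₀ _ ha0]⟩

/-- Along a link, vanishing of the component of degree `b - 2` puts the component of degree `b` into
`Rad(Q)`, hence makes it zero if `b ≠ 0`. So membership in the filtration improves by 2 at each
step, up to a radical component in degree 0 which the singularity of `y i` removes. -/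
theorem mem_filtration_of_chain (hQ : Q.Nondegenerate) (h𝒱 : IsOGood Q 𝒱)
    (hη : η ∈ formsTwo 𝒱) {M : ℕ} {y : ℕ → V} (hy0 : y 0 ∈ filtration 𝒱 (-M))
    (hlink : ∀ i < M, η (y i) = Q.polarBilin (y (i + 1)))
    (hyQ : ∀ i ≤ M, M < 2 * i → Q (y i) = 0) {i : ℕ} (hi : i ≤ M) :
    y i ∈ filtration 𝒱 (2 * i - M) := by
  induction i with
  | zero => simpa using hy0
  | succ i ih =>
    have ih := mem_filtration_iff.1 (ih (by omega))
    have hrad : ∀ b < 2 * ((i + 1 : ℕ) : ℤ) - M,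
        Q.polarBilin (homComponent 𝒱 b (y (i + 1))) = 0 := by
      intro b hb
      push_cast at hb
      rw [← link_homComponent h𝒱 hη (hlink i (by omega)), ih (b - 2) (by omega), map_zero]
    have hne : ∀ b < 2 * ((i + 1 : ℕ) : ℤ) - M, b ≠ 0 →
        homComponent 𝒱 b (y (i + 1)) = 0 := fun b hb hb0 =>
      eq_zero_of_polarBilin_eq_zero hQ h𝒱 hb0 (homComponent_mem 𝒱 _ _) (hrad b hb)
    rw [mem_filtration_iff]
    intro b hb
    -- For `b = 0` the negative components already vanish, so `Q (y (i + 1))` equals `Q` of the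
    -- degree 0 component; the latter is thus singular as well as radical.
    by_cases hb0 : b = 0
    · subst hb0
      refine eq_zero_of_mem_ker hQ ?_ (hrad 0 hb)
      rw [← quadraticForm_filtration_zero h𝒱 (mem_filtration_iff.2 fun c hc =>
        hne c (by omega) (by omega))]
      exact hyQ _ hi (by omega)
    · exact hne b hb hb0

/-- Only the leading component of `v` matters, the rest being covered by `hup`. The image under `g`
of the chain ending there is again a chain; it starts in `V^{≥ -M}`, and past the middle it consists
of singular vectors. -/
theorem map_mem_filtration_of_chains (hQ : Q.Nondegenerate) (h𝒱 : IsOGood Q 𝒱)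
    (hη : η ∈ formsTwo 𝒱) (hgQ : ∀ v, Q (g v) = Q v) (hgη : ∀ v w, η (g v) (g w) = η v w)
    {M : ℕ} (hup : ∀ v ∈ filtration 𝒱 ((M : ℤ) + 1), g v ∈ filtration 𝒱 ((M : ℤ) + 1))
    (hlow : ∀ v ∈ filtration 𝒱 (-(M : ℤ)), g v ∈ filtration 𝒱 (-(M : ℤ)))
    (hchain : ∀ v ∈ 𝒱 M, ∃ y : ℕ → V, y M = v ∧ (∀ i : ℕ, y i ∈ 𝒱 (2 * i - M)) ∧
      ∀ i, η (y i) = Q.polarBilin (y (i + 1)))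
    {v : V} (hv : v ∈ filtration 𝒱 M) : g v ∈ filtration 𝒱 M := by
  rw [← add_sub_cancel (homComponent 𝒱 M v) v, map_add]
  refine add_mem ?_ (filtration_anti (by omega) (hup _ (sub_homComponent_mem_filtration hv)))
  obtain ⟨y, hyM, hy, hlink⟩ := hchain _ (homComponent_mem 𝒱 M v)
  rw [← hyM]
  have := mem_filtration_of_chain hQ h𝒱 hη (M := M) (y := fun i => g (y i))
    (hlow _ (mem_filtration_of_mem (by simp) (hy 0))) (fun i _ => link_map hgQ hgη (hlink i))
    (fun i _ hi => by rw [hgQ]; exact h𝒱.isotropic _ (by omega) _ (hy i)) (i := M) le_rfl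
  convert this using 2
  ring

/-- The components `w i` of degree `2i - 2l` form a homogeneous chain. Its middle term is singular,
killed by `A^l` and orthogonal to `ker A^l` in `V^0`, hence zero by nondegeneracy. Then `w 0` is
orthogonal to `A^l V^0 = V^{2l}`, so it vanishes too. -/
theorem chainStart_subset (hA : IsRaisingMap Q 𝒱 η A) (hQ : Q.Nondegenerate)
    (h𝒱 : IsOGood Q 𝒱) (hη : η ∈ formsTwo 𝒱) {l : ℕ} (hl : 1 ≤ l)
    (hsurj : ∀ v ∈ 𝒱 (2 * l), ∃ z ∈ 𝒱 0, (A ^ l) z = v)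
    (hK : ∀ u ∈ 𝒱 0, (A ^ l) u = 0 → Q u = 0 →
      (∀ z ∈ 𝒱 0, (A ^ l) z = 0 → Q.polarBilin u z = 0) → u = 0)
    {x : V} (hx : x ∈ chainStart Q 𝒱 η l) : x ∈ filtration 𝒱 (1 - 2 * l) := by
  obtain ⟨y, rfl, h0, h1, h2, h3⟩ := hx
  let w : ℕ → V := fun i => homComponent 𝒱 (2 * i - 2 * l) (y i)
  have hw : ∀ i : ℕ, w i ∈ 𝒱 (2 * i - 2 * l) := fun i => homComponent_mem 𝒱 _ _
  have hlink : ∀ i < 2 * l, η (w i) = Q.polarBilin (w (i + 1)) := fun i hi => by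
    have := link_homComponent h𝒱 hη (h1 i hi) (2 * ((i + 1 : ℕ) : ℤ) - 2 * l)
    have e : 2 * ((i + 1 : ℕ) : ℤ) - 2 * l - 2 = 2 * i - 2 * l := by push_cast; ring
    rw [e] at this
    exact this
  have hwl : w l ∈ 𝒱 0 := by simpa using hw l
  have hwA : ∀ j ≤ l, w (l + j) = (A ^ j) (w l) := by
    intro j hj
    induction j with
    | zero => rfl
    | succ j ih =>
      have e1 : w (l + j) ∈ 𝒱 (2 * j) := by
        convert hw (l + j) using 2
        push_cast
        ring
      have e2 := hA.polarBilin_eq h𝒱 hη (by omega) e1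
      rw [hlink (l + j) (by omega)] at e2
      have e3 : w (l + j + 1) ∈ 𝒱 (2 * j + 2) := by
        convert hw (l + j + 1) using 2
        push_cast
        ring
      have e4 := hA.map_mem _ (by omega) _ e1
      rw [pow_succ', Module.End.mul_apply, ← ih (by omega)]
      refine sub_eq_zero.1 (eq_zero_of_polarBilin_eq_zero hQ h𝒱 (by omega) (sub_mem e3 e4) ?_)
      rw [map_sub, ← e2]
      exact sub_self _
  have hQw : Q (w l) = 0 := by
    have := mem_filtration_of_chain hQ h𝒱 hη (M := 2 * l) (y := y) (by exact_mod_cast h0)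
      h1 (fun i hi hi' => h2 i (by omega) hi) (i := l) (by omega)
    push_cast at this
    rw [sub_self] at this
    have e := quadraticForm_filtration_zero h𝒱 this
    rw [h2 l le_rfl (by omega)] at e
    change Q (homComponent 𝒱 (2 * l - 2 * l) (y l)) = 0
    rw [sub_self, ← e]
  have hAw : (A ^ l) (w l) = 0 := by
    rw [← hwA l le_rfl, ← two_mul]
    refine mem_filtration_iff.1 h3 _ ?_
    push_cast
    omega
  have hpair : ∀ z ∈ 𝒱 0, Q.polarBilin (w l) z = (-1) ^ l * Q.polarBilin ((A ^ l) z) (w 0) :=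
    fun z hz => polarBilin_chain hA h𝒱 hη (fun i hi => hlink i (by omega))
      (fun i _ => by omega) hz
  have hwl0 : w l = 0 := hK _ hwl hAw hQw fun z hz hz' => by
    rw [hpair z hz, hz']
    simp
  have hw0 : w 0 = 0 := by
    have hw0' : w 0 ∈ 𝒱 (-(2 * l)) := by simpa using hw 0
    refine eq_zero_of_polarBilin hQ h𝒱 (by omega) hw0' fun v hv => ?_
    rw [neg_neg] at hv
    obtain ⟨z, hz, rfl⟩ := hsurj v hv
    have := hpair z hz
    rw [hwl0, map_zero, LinearMap.zero_apply, eq_comm, mul_eq_zero] at this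
    rw [polarBilin_symm]
    exact this.resolve_left (by simp)
  have := sub_homComponent_mem_filtration h0
  have e : homComponent 𝒱 (-(2 * (l : ℤ))) (y 0) = 0 := by simpa [w] using hw0
  rw [e, sub_zero] at this
  convert this using 2
  ring

theorem mem_chainStart_of_chain (h𝒱 : IsOGood Q 𝒱) {l : ℕ} {b : ℤ}
    (hb : 1 - 2 * (l : ℤ) ≤ b) {y : ℕ → V} (hy : ∀ i : ℕ, y i ∈ 𝒱 (b + 2 * i))
    (hlink : ∀ i, η (y i) = Q.polarBilin (y (i + 1))) : y 0 ∈ chainStart Q 𝒱 η l := by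
  refine ⟨y, rfl, mem_filtration_of_mem ?_ (hy 0), fun i _ => hlink i, fun i hi _ => ?_,
    mem_filtration_of_mem ?_ (hy (2 * l))⟩
  · simp
    omega
  · exact h𝒱.isotropic _ (by omega) _ (hy i)
  · push_cast
    omega

/-- Here `hb'` says that `b` is not a negative even integer, so that iterating `A` never needs a
value on `V^{-2}`. -/
theorem mem_chainStart_of_forall_ne (hA : IsRaisingMap Q 𝒱 η A) (h𝒱 : IsOGood Q 𝒱)
    (hη : η ∈ formsTwo 𝒱) {l : ℕ} {b : ℤ} (hb : 1 - 2 * (l : ℤ) ≤ b)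
    (hb' : ∀ i : ℕ, b + 2 * i ≠ -2) {x : V} (hx : x ∈ 𝒱 b) : x ∈ chainStart Q 𝒱 η l := by
  refine mem_chainStart_of_chain h𝒱 hb (y := fun i => (A ^ i) x)
    (fun i => hA.pow_mem (fun j _ => hb' j) hx) fun i => ?_
  rw [hA.polarBilin_eq h𝒱 hη (hb' i) (hA.pow_mem (fun j _ => hb' j) hx), pow_succ',
    Module.End.mul_apply]

/-- A chain from `V^{-2j}` has to cross `V^0` at some `u` with `β(u, z) = ± β(x, A^j z)`. Such a `u`
exists exactly when the right side kills `Rad(Q)`, which is `hxr`. Surjectivity of `A^j` then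
identifies the start of the chain through `u` with `x`. -/
theorem mem_chainStart_of_polarBilin_eq_zero [FiniteDimensional k V]
    (hA : IsRaisingMap Q 𝒱 η A) (hQ : Q.Nondegenerate)
    (h𝒱 : IsOGood Q 𝒱) (hη : η ∈ formsTwo 𝒱) {l j : ℕ} (hj : 1 ≤ j) (hjl : j < l)
    (hsurj : ∀ v ∈ 𝒱 (2 * j), ∃ z ∈ 𝒱 0, (A ^ j) z = v) {x : V} (hx : x ∈ 𝒱 (-(2 * j)))
    (hxr : ∀ r, Q.polarBilin r = 0 → Q.polarBilin ((A ^ j) r) x = 0) :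
    x ∈ chainStart Q 𝒱 η l := by
  obtain ⟨u', hu'⟩ := exists_eq_of_vanish_on_ker Q.polarBilin (polarBilin_symm Q)
    (((-1 : k) ^ j) • (Q.polarBilin x ∘ₗ (A ^ j))) fun r hr => by
      rw [LinearMap.smul_apply, LinearMap.comp_apply, polarBilin_symm, hxr r hr, smul_zero]
  set u := homComponent 𝒱 0 u' with hudef
  have hu : ∀ z ∈ 𝒱 0, Q.polarBilin u z = (-1) ^ j * Q.polarBilin x ((A ^ j) z) := by
    intro z hz
    rw [hudef, polarBilin_homComponent_left h𝒱 (by rwa [neg_zero]), hu']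
    rfl
  obtain ⟨y, hyj, -, hy, hlink⟩ := exists_chain_of_mem_zero hA hQ h𝒱 hη hj (u := u)
    (homComponent_mem 𝒱 0 u') fun z hz hz' => by rw [hu z hz, hz', map_zero, mul_zero]
  have hy0 : y 0 ∈ 𝒱 (-(2 * j)) := by simpa using hy 0
  have hyx : y 0 = x := by
    refine sub_eq_zero.1 (eq_zero_of_polarBilin hQ h𝒱 (by omega) (sub_mem hy0 hx) fun v hv => ?_)
    rw [neg_neg] at hv
    obtain ⟨z, hz, rfl⟩ := hsurj v hv
    have h1 := polarBilin_chain hA h𝒱 hη (fun i (_ : i < j) => hlink i) (fun i _ => by omega) hz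
    rw [hyj, hu z hz] at h1
    have h2 := mul_left_cancel₀ (by simp) h1
    rw [map_sub, LinearMap.sub_apply, h2, polarBilin_symm Q (y 0), sub_self]
  rw [← hyx]
  refine mem_chainStart_of_chain h𝒱 (b := -(2 * j)) (by omega) (fun i => ?_) hlink
  convert hy i using 2
  ring

/-- Put `w = g v`. It is `β`-orthogonal to all chain starts, which cuts its component in degree
`2j`, `0 ≤ j < l`, down to a multiple of `A^j r` and kills the other components between `-2l` and
`2l`. It is also `η`-orthogonal to `V^{≥ -2l}`, so `A` kills that multiple; since `A^{j+1} r ≠ 0`,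
the coefficient is zero. At the bottom, degree `-2l` pairs with the vectors of `V^{2l}`, which are
chain starts. -/
theorem map_mem_filtration_of_pow_ne_zero [FiniteDimensional k V]
    (hA : IsRaisingMap Q 𝒱 η A) (hQ : Q.Nondegenerate)
    (h𝒱 : IsOGood Q 𝒱) (hη : η ∈ formsTwo 𝒱) (hgQ : ∀ v, Q (g v) = Q v)
    (hgη : ∀ v w, η (g v) (g w) = η v w) {l : ℕ} (hl : 1 ≤ l)
    (hup : ∀ v ∈ filtration 𝒱 (2 * (l : ℤ) + 1), g.symm v ∈ filtration 𝒱 (2 * (l : ℤ) + 1))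
    (hlow : ∀ v, g v ∈ filtration 𝒱 (-(2 * (l : ℤ))) ↔ v ∈ filtration 𝒱 (-(2 * (l : ℤ))))
    (hsurj : ∀ j : ℕ, ∀ v ∈ 𝒱 (2 * j), ∃ z ∈ 𝒱 0, (A ^ j) z = v)
    (hK : ∀ u ∈ 𝒱 0, (A ^ l) u = 0 → Q u = 0 →
      (∀ z ∈ 𝒱 0, (A ^ l) z = 0 → Q.polarBilin u z = 0) → u = 0)
    {r : V} (hr : Q.polarBilin r = 0) (hAr : (A ^ l) r ≠ 0)
    {v : V} (hv : v ∈ filtration 𝒱 (2 * l)) : g v ∈ filtration 𝒱 (2 * l) := by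
  have hr0 : r ≠ 0 := by
    rintro rfl
    exact hAr (map_zero _)
  have hrmem : r ∈ 𝒱 0 := mem_zero_of_polarBilin_eq_zero hQ h𝒱 hr
  have hsymmlow : ∀ v ∈ filtration 𝒱 (-(2 * (l : ℤ))),
      g.symm v ∈ filtration 𝒱 (-(2 * (l : ℤ))) := fun v hv => by
    rwa [← hlow, g.apply_symm_apply]
  have hsymm : ∀ x ∈ chainStart Q 𝒱 η l, g.symm x ∈ chainStart Q 𝒱 η l := fun x hx =>
    map_mem_chainStart (g := g.symm) (fun v => by rw [← hgQ, g.apply_symm_apply])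
      (fun v w => by rw [← hgη, g.apply_symm_apply, g.apply_symm_apply]) hup hsymmlow hx
  have hgv : g v ∈ filtration 𝒱 (-(2 * (l : ℤ))) := (hlow v).2 (filtration_anti (by omega) hv)
  -- The inverse of `g` preserves the chain starts, and `chainStart_subset` places these in `V^{≥
  -- 1-2l}`, which is orthogonal to `V^{≥ 2l}`.
  have hD : ∀ x ∈ chainStart Q 𝒱 η l, Q.polarBilin (g v) x = 0 := fun x hx => by
    rw [polarBilin_symm_map hgQ]
    exact polarBilin_filtration h𝒱 (by omega) hv
      (chainStart_subset hA hQ h𝒱 hη hl (hsurj l) hK (hsymm x hx))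
  have hE : ∀ x ∈ filtration 𝒱 (-(2 * (l : ℤ))), η (g v) x = 0 := fun x hx => by
    rw [form_symm_map hgη]
    exact form_filtration hη (by omega) hv (hsymmlow x hx)
  generalize g v = w at hgv hD hE
  rw [mem_filtration_iff] at hgv ⊢
  intro b hb
  by_cases hb1 : b < -(2 * l)
  · exact hgv b hb1
  -- This fails exactly for `b = 2j` with `j ≥ 1`, where a hyperplane of `V^{-b}`, at least, still
  -- consists of chain starts.
  by_cases hb2 : ∀ i : ℕ, -b + 2 * i ≠ -2
  · by_cases hb0 : b = 0
    · subst hb0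
      have hw0 : Q.polarBilin (homComponent 𝒱 0 w) = 0 := by
        refine polarBilin_eq_zero_of_mem h𝒱 (homComponent_mem 𝒱 0 w) fun z hz => ?_
        rw [polarBilin_homComponent_left h𝒱 hz]
        exact hD z (mem_chainStart_of_forall_ne hA h𝒱 hη (by omega) hb2 hz)
      obtain ⟨c, hc⟩ := exists_eq_smul_of_polarBilin_eq_zero hQ hr0 hr hw0
      rw [hc]
      have h1 : η (homComponent 𝒱 0 w) = 0 := by
        ext z
        rw [form_eq_homComponent hη (homComponent_mem 𝒱 0 w),
          form_homComponent_left hη (homComponent_mem 𝒱 _ z)]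
        exact hE _ (mem_filtration_of_mem (by omega) (homComponent_mem 𝒱 _ z))
      rw [hA.polarBilin_eq h𝒱 hη (by norm_num) (homComponent_mem 𝒱 0 w)] at h1
      have h2 := eq_zero_of_polarBilin_eq_zero hQ h𝒱 (by norm_num)
        (hA.map_mem 0 (by norm_num) _ (homComponent_mem 𝒱 0 w)) h1
      rw [hc, map_smul, smul_eq_zero] at h2
      rcases h2 with h2 | h2
      · rw [h2, zero_smul]
      · obtain ⟨m, rfl⟩ : ∃ m, l = m + 1 := ⟨l - 1, by omega⟩
        rw [pow_succ, Module.End.mul_apply, h2, map_zero] at hAr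
        exact absurd rfl hAr
    · refine eq_zero_of_polarBilin hQ h𝒱 hb0 (homComponent_mem 𝒱 b w) fun z hz => ?_
      rw [polarBilin_homComponent_left h𝒱 hz]
      exact hD z (mem_chainStart_of_forall_ne hA h𝒱 hη (by omega) hb2 hz)
  · push Not at hb2
    obtain ⟨i, hi⟩ := hb2
    obtain ⟨j, hj, rfl⟩ : ∃ j : ℕ, 1 ≤ j ∧ b = 2 * j := ⟨i + 1, by omega, by push_cast; omega⟩
    have hjr := hA.pow_mem (n := j) (fun i _ => by omega) hrmem
    rw [zero_add] at hjr
    set u := homComponent 𝒱 (2 * j) w with hu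
    have humem : u ∈ 𝒱 (2 * j) := homComponent_mem 𝒱 _ w
    obtain ⟨c, hc⟩ := exists_eq_smul_of_ker_le (f := Q.polarBilin ((A ^ j) r))
      (g := Q.polarBilin u) fun x hx => by
        rw [polarBilin_eq_homComponent h𝒱 hjr] at hx
        rw [polarBilin_eq_homComponent h𝒱 humem,
          polarBilin_homComponent_left h𝒱 (homComponent_mem 𝒱 _ x)]
        refine hD _ (mem_chainStart_of_polarBilin_eq_zero hA hQ h𝒱 hη hj (by omega) (hsurj j)
          (homComponent_mem 𝒱 _ x) fun r' hr' => ?_)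
        obtain ⟨c, rfl⟩ := exists_eq_smul_of_polarBilin_eq_zero hQ hr0 hr hr'
        rw [map_smul, map_smul, LinearMap.smul_apply, hx, smul_zero]
    have hu2 : u = c • (A ^ j) r := by
      refine sub_eq_zero.1 (eq_zero_of_polarBilin_eq_zero hQ h𝒱 (a := 2 * j) (by omega)
        (sub_mem humem (Submodule.smul_mem _ _ hjr)) ?_)
      rw [map_sub, hc, map_smul, sub_self]
    have h1 : η u = 0 := by
      ext z
      rw [form_eq_homComponent hη humem, form_homComponent_left hη (homComponent_mem 𝒱 _ z)]
      exact hE _ (mem_filtration_of_mem (by omega) (homComponent_mem 𝒱 _ z))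
    rw [hA.polarBilin_eq h𝒱 hη (by omega) humem] at h1
    have h2 := eq_zero_of_polarBilin_eq_zero hQ h𝒱 (by omega)
      (hA.map_mem _ (by omega) _ humem) h1
    rw [hu2, map_smul, smul_eq_zero] at h2
    rcases h2 with h2 | h2
    · rw [hu2, h2, zero_smul]
    · obtain ⟨m, rfl⟩ : ∃ m, l = m + (j + 1) := ⟨l - (j + 1), by omega⟩
      rw [← Module.End.mul_apply, ← pow_succ'] at h2
      rw [pow_add, Module.End.mul_apply, h2, map_zero] at hAr
      exact absurd rfl hAr

end Recover

/-! ### Stabilizers of forms in `𝔖(V)_2^0` preserve the filtration -/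

section Sufficiency

variable {Q : QuadraticForm k V} {𝒱 : ℤ → Submodule k V} {η : LinearMap.BilinForm k V}
  {A : Module.End k V}

theorem exists_pow_eq_of_map_eq {c : ℤ}
    (h : ∀ i : ℕ, (𝒱 (c + 2 * i)).map A = 𝒱 (c + 2 * i + 2)) (n : ℕ) :
    ∀ v ∈ 𝒱 (c + 2 * n), ∃ z ∈ 𝒱 c, (A ^ n) z = v := by
  induction n with
  | zero => exact fun v hv => ⟨v, by simpa using hv, rfl⟩
  | succ n ih =>
    intro v hv
    have e : c + 2 * ((n + 1 : ℕ) : ℤ) = c + 2 * n + 2 := by push_cast; ring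
    rw [e, ← h n] at hv
    obtain ⟨w, hw, rfl⟩ := hv
    obtain ⟨z, hz, rfl⟩ := ih w hw
    exact ⟨z, hz, by rw [pow_succ', Module.End.mul_apply]⟩

theorem map_filtration_eq [FiniteDimensional k V] {g : V ≃ₗ[k] V} {a : ℤ}
    (h : ∀ v ∈ filtration 𝒱 a, g v ∈ filtration 𝒱 a) :
    (filtration 𝒱 a).map (g : V →ₗ[k] V) = filtration 𝒱 a := by
  refine Submodule.eq_of_le_of_finrank_eq ?_ (LinearEquiv.finrank_map_eq g _)
  rintro _ ⟨v, hv, rfl⟩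
  exact h v hv

variable [DirectSum.Decomposition 𝒱]

/-- Write `v = A^{n+1} z` with `z ∈ V^{-1}`. Nondegeneracy on `ker A^{n+1}` allows `z` to be made
orthogonal to this kernel without changing `v`, and it is then of the form `A^n x`. -/
theorem exists_chain_odd [FiniteDimensional k V] (hA : IsRaisingMap Q 𝒱 η A)
    (hQ : Q.Nondegenerate) (h𝒱 : IsOGood Q 𝒱) (hη : η ∈ formsTwo 𝒱)
    (hsurj : ∀ n : ℕ, (𝒱 (2 * n - 1)).map A = 𝒱 (2 * n + 1))
    (hK : ∀ n : ℕ, 1 ≤ n → (LinearMap.BilinForm.restrict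
      (LinearMap.BilinForm.compLeft Q.polarBilin A) (𝒱 (-1) ⊓ (A ^ n).ker)).Nondegenerate)
    (n : ℕ) {v : V} (hv : v ∈ 𝒱 (2 * n + 1)) :
    ∃ y : ℕ → V, y (2 * n + 1) = v ∧ (∀ i : ℕ, y i ∈ 𝒱 (2 * i - (2 * n + 1))) ∧
      ∀ i, η (y i) = Q.polarBilin (y (i + 1)) := by
  have hs : ∀ j : ℕ, ∀ v ∈ 𝒱 (-1 + 2 * j), ∃ z ∈ 𝒱 (-1), (A ^ j) z = v :=
    exists_pow_eq_of_map_eq fun i => by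
      rw [show (-1 + 2 * (i : ℤ)) = 2 * i - 1 by ring, hsurj i]
      congr 1
      ring
  obtain ⟨z, hz, rfl⟩ := hs (n + 1) v (by convert hv using 2; push_cast; ring)
  have hform : ∀ x ∈ 𝒱 (-1), η x = Q.polarBilin (A x) := fun x hx =>
    hA.polarBilin_eq h𝒱 hη (by norm_num) hx
  obtain ⟨w, hw, hw'⟩ := exists_sub_orthogonal η (𝒱 (-1) ⊓ (A ^ (n + 1)).ker)
    (fun x hx hx0 => by
      have := (hK (n + 1) (by omega)).1 ⟨x, hx⟩ fun y => by
        change Q.polarBilin (A x) y = 0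
        rw [← hform x hx.1]
        exact hx0 y y.2
      exact congrArg Subtype.val this) z
  obtain ⟨x, hx, hxu⟩ := exists_pow_eq_of_mem_neg_one hA hQ h𝒱 hη (n := n) (u := z - w)
    (sub_mem hz hw.1) fun t ht ht' => by
      obtain ⟨s, hs', rfl⟩ := hs 1 t (by simpa using ht)
      rw [pow_one, polarBilin_symm, ← hform s hs', form_swap hη.1, hw' s ⟨hs', ?_⟩, neg_zero]
      change (A ^ (n + 1)) s = 0
      rw [pow_succ, Module.End.mul_apply]
      simpa using ht'
  have hodd : Odd (-(1 + 2 * (n : ℤ))) := by simp [parity_simps]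
  refine ⟨fun i => (A ^ i) x, ?_, fun i => ?_, fun i => (odd_chain hA h𝒱 hη hodd hx i).2⟩
  · have e : 2 * n + 1 = (n + 1) + n := by ring
    have hw2 : (A ^ (n + 1)) w = 0 := hw.2
    dsimp only
    rw [e, pow_add, Module.End.mul_apply, hxu, map_sub, hw2, sub_zero]
  · convert (odd_chain hA h𝒱 hη hodd hx i).1 using 2
    ring

/-- As in odd degrees, the preimage of `v` in `V^0` is made orthogonal to `ker A^l`. Since `β` can
be degenerate on this kernel, the correction requires `hr`, that the kernel contains `Rad(Q)`. -/
theorem exists_chain_even [IsAlgClosed k] [FiniteDimensional k V] (hA : IsRaisingMap Q 𝒱 η A)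
    (hQ : Q.Nondegenerate) (hV : Odd (Module.finrank k V)) (h𝒱 : IsOGood Q 𝒱)
    (hη : η ∈ formsTwo 𝒱) {l : ℕ} (hl : 1 ≤ l)
    (hsurj : ∀ v ∈ 𝒱 (2 * l), ∃ z ∈ 𝒱 0, (A ^ l) z = v)
    (hK : (Q.comp (𝒱 0 ⊓ (A ^ l).ker).subtype).Nondegenerate)
    (hr : ∀ r, Q.polarBilin r = 0 → (A ^ l) r = 0) {v : V} (hv : v ∈ 𝒱 (2 * l)) :
    ∃ y : ℕ → V, y (2 * l) = v ∧ (∀ i : ℕ, y i ∈ 𝒱 (2 * i - 2 * l)) ∧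
      ∀ i, η (y i) = Q.polarBilin (y (i + 1)) := by
  obtain ⟨z, hz, rfl⟩ := hsurj v hv
  obtain ⟨w, hw, hw'⟩ := exists_sub_orthogonal_of_ker_le hQ hV (𝒱 0 ⊓ (A ^ l).ker)
    ((nondegenerate_comp_subtype_iff _ _).1 hK)
    (fun r hr0 => ⟨mem_zero_of_polarBilin_eq_zero hQ h𝒱 hr0, hr r hr0⟩) z
  obtain ⟨y, -, hyA, hy, hlink⟩ := exists_chain_of_mem_zero hA hQ h𝒱 hη hl (u := z - w)
    (sub_mem hz hw.1) fun t ht ht' => hw' t ⟨ht, ht'⟩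
  refine ⟨y, ?_, hy, hlink⟩
  have hw2 : (A ^ l) w = 0 := hw.2
  rw [two_mul, hyA, map_sub, hw2, sub_zero]

theorem map_filtration_eq_of_mem_formsTwoZero [IsAlgClosed k] [FiniteDimensional k V]
    (hQ : Q.Nondegenerate) (hV : Odd (Module.finrank k V)) (h𝒱 : IsOGood Q 𝒱)
    (hη : η ∈ formsTwoZero Q 𝒱) {g : V ≃ₗ[k] V} (hgQ : ∀ v, Q (g v) = Q v)
    (hgη : ∀ v w, η (g v) (g w) = η v w) (a : ℤ) :
    (filtration 𝒱 a).map (g : V →ₗ[k] V) = filtration 𝒱 a := by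
  obtain ⟨hη, A, hA, hs0, hK0, hs1, hK1⟩ := hη
  obtain ⟨B, hB⟩ := exists_filtration_eq_bot (𝒱 := 𝒱)
  have hs : ∀ j : ℕ, ∀ v ∈ 𝒱 (2 * j), ∃ z ∈ 𝒱 0, (A ^ j) z = v := by
    have := exists_pow_eq_of_map_eq (𝒱 := 𝒱) (A := A) (c := 0) fun i => by
      rw [zero_add]
      exact hs0 i
    simpa only [zero_add] using this
  have hlow : ∀ M : ℕ, (∀ g : V ≃ₗ[k] V, (∀ v, Q (g v) = Q v) →
      (∀ v w, η (g v) (g w) = η v w) →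
      ∀ v ∈ filtration 𝒱 ((M : ℤ) + 1), g v ∈ filtration 𝒱 ((M : ℤ) + 1)) →
      ∀ g : V ≃ₗ[k] V, (∀ v, Q (g v) = Q v) → (∀ v w, η (g v) (g w) = η v w) →
      ∀ v ∈ filtration 𝒱 (-(M : ℤ)), g v ∈ filtration 𝒱 (-(M : ℤ)) := by
    intro M h g hgQ hgη v hv
    rw [mem_filtration_iff_orthogonal hQ h𝒱 (by omega)] at hv ⊢
    intro w hw
    rw [polarBilin_symm_map hgQ]
    refine hv _ (h g.symm (fun v => by rw [← hgQ, g.apply_symm_apply])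
      (fun v w => by rw [← hgη, g.apply_symm_apply, g.apply_symm_apply]) w hw)
  -- Downward induction on `M`, measured by `n` and starting where `V^{≥ B} = 0`. All stabilizing
  -- isometries are treated at once because the step also uses the inverse of `g`.
  have key : ∀ n M : ℕ, 1 ≤ M → B ≤ M + n → ∀ g : V ≃ₗ[k] V, (∀ v, Q (g v) = Q v) →
      (∀ v w, η (g v) (g w) = η v w) →
      ∀ v ∈ filtration 𝒱 (M : ℤ), g v ∈ filtration 𝒱 (M : ℤ) := by
    intro n
    induction n with
    | zero =>
      intro M _ hM g _ _ v hv
      have : v ∈ filtration 𝒱 (B : ℤ) := filtration_anti (by omega) hv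
      rw [hB, Submodule.mem_bot] at this
      rw [this, map_zero]
      exact zero_mem _
    | succ n ih =>
      intro M hM1 hM g hgQ hgη v hv
      have hup := ih (M + 1) (by omega) (by omega)
      push_cast at hup
      have hlo := hlow M hup
      have hgQ' : ∀ v, Q (g.symm v) = Q v := fun v => by rw [← hgQ, g.apply_symm_apply]
      have hgη' : ∀ v w, η (g.symm v) (g.symm w) = η v w := fun v w => by
        rw [← hgη, g.apply_symm_apply, g.apply_symm_apply]
      rcases Nat.even_or_odd' M with ⟨l, rfl | rfl⟩
      · push_cast at hv hup hlo ⊢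
        -- If `A^l` kills `Rad(Q)`, every vector of `V^{2l}` ends a homogeneous chain; otherwise the
        -- orthogonality argument takes over.
        by_cases hr : ∀ r, Q.polarBilin r = 0 → (A ^ l) r = 0
        · have := map_mem_filtration_of_chains hQ h𝒱 hη hgQ hgη (M := 2 * l)
            (by exact_mod_cast hup g hgQ hgη) (by exact_mod_cast hlo g hgQ hgη)
            (fun v hv => by
              push_cast at hv ⊢
              exact exists_chain_even hA hQ hV h𝒱 hη (by omega) (hs l) (hK0 l (by omega)) hr hv)
            (v := v) (by exact_mod_cast hv)
          exact_mod_cast this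
        · push Not at hr
          obtain ⟨r, hr, hAr⟩ := hr
          refine map_mem_filtration_of_pow_ne_zero hA hQ h𝒱 hη hgQ hgη (by omega)
            (hup g.symm hgQ' hgη') (fun v => ⟨fun h => ?_, hlo g hgQ hgη v⟩) hs
            (fun u hu hAu hQu hz => ?_) hr hAr hv
          · have := hlo g.symm hgQ' hgη' _ h
            rwa [g.symm_apply_apply] at this
          · exact (nondegenerate_comp_subtype_iff _ _).1 (hK0 l (by omega)) u ⟨hu, hAu⟩ hQu
              fun z hz' => hz z hz'.1 hz'.2
      · exact map_mem_filtration_of_chains hQ h𝒱 hη hgQ hgη (hup g hgQ hgη) (hlo g hgQ hgη)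
          (fun v hv => by
            push_cast at hv ⊢
            exact exists_chain_odd hA hQ h𝒱 hη hs1 hK1 l hv) hv
  have hpos : ∀ M : ℕ, 1 ≤ M → ∀ g : V ≃ₗ[k] V, (∀ v, Q (g v) = Q v) →
      (∀ v w, η (g v) (g w) = η v w) →
      ∀ v ∈ filtration 𝒱 (M : ℤ), g v ∈ filtration 𝒱 (M : ℤ) :=
    fun M hM => key B M hM (by omega)
  refine map_filtration_eq ?_
  rcases lt_or_ge 0 a with ha | ha
  · lift a to ℕ using ha.le
    exact hpos a (by omega) g hgQ hgη
  · obtain ⟨M, rfl⟩ : ∃ M : ℕ, a = -M := ⟨(-a).toNat, by omega⟩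
    refine hlow M ?_ g hgQ hgη
    exact_mod_cast hpos (M + 1) (by omega)

end Sufficiency

/-! ### Linear forms on `𝔤` and alternating forms on `V` -/

section Coadjoint

variable (Q : QuadraticForm k V)

/-- The endomorphism `v ∧ w : u ↦ β(w, u) v - β(v, u) w` of `V`. -/
def wedge : V →ₗ[k] V →ₗ[k] Module.End k V :=
  LinearMap.mk₂ k (fun v w => (Q.polarBilin w).smulRight v - (Q.polarBilin v).smulRight w)
    (fun v v' w => by
      ext u
      simp only [LinearMap.sub_apply, LinearMap.add_apply, LinearMap.smulRight_apply, map_add]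
      module)
    (fun c v w => by
      ext u
      simp only [LinearMap.sub_apply, LinearMap.smul_apply, LinearMap.smulRight_apply, map_smul,
        smul_eq_mul]
      module)
    (fun v w w' => by
      ext u
      simp only [LinearMap.sub_apply, LinearMap.add_apply, LinearMap.smulRight_apply, map_add]
      module)
    (fun c v w => by
      ext u
      simp only [LinearMap.sub_apply, LinearMap.smul_apply, LinearMap.smulRight_apply, map_smul,
        smul_eq_mul]
      module)

variable {Q}

theorem wedge_apply (v w u : V) :
    wedge Q v w u = Q.polarBilin w u • v - Q.polarBilin v u • w := rfl

theorem wedge_mem_orthLie (v w : V) : wedge Q v w ∈ orthLie Q := by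
  refine ⟨fun u => ?_, fun u hu => ?_⟩
  · rw [wedge_apply, map_sub, map_smul, map_smul, LinearMap.sub_apply, LinearMap.smul_apply,
      LinearMap.smul_apply, smul_eq_mul, smul_eq_mul]
    ring
  · rw [LinearMap.mem_ker] at hu
    rw [wedge_apply, polarBilin_symm Q w, polarBilin_symm Q v, hu]
    simp

theorem trace_mul_wedge [FiniteDimensional k V] (X : Module.End k V) (v w : V) :
    LinearMap.trace k V (X * wedge Q v w) = formOfEnd Q X v w := by
  change LinearMap.trace k V (X * ((Q.polarBilin w).smulRight v - (Q.polarBilin v).smulRight w)) = _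
  rw [mul_sub, map_sub, trace_comp_smulRight, trace_comp_smulRight, formOfEnd_apply,
    polarBilin_symm Q (X v)]

theorem formOfDual_apply [FiniteDimensional k V] (ξ : Module.Dual k (orthLie Q)) (v w : V) :
    formOfDual Q ξ v w = ξ ⟨wedge Q v w, wedge_mem_orthLie v w⟩ := by
  obtain ⟨X, hX⟩ := exists_trace_eq Q ξ
  rw [formOfDual_eq Q ξ X hX, hX, trace_mul_wedge]

theorem formOfDual_isAlt [FiniteDimensional k V] (ξ : Module.Dual k (orthLie Q)) :
    (formOfDual Q ξ).IsAlt := by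
  intro v
  rw [formOfDual_apply]
  convert map_zero ξ
  ext u
  rw [wedge_apply, sub_self]
  rfl

theorem sum_sum_eq_sum_sum_ite {ι M : Type*} [Fintype ι] [LinearOrder ι] [AddCommMonoid M]
    (a : ι → ι → M) (ha : ∀ i, a i i = 0) :
    ∑ i, ∑ j, a i j = ∑ i, ∑ j, if i < j then a i j + a j i else 0 := by
  have h1 : ∀ i j, a i j = (if i < j then a i j else 0) + (if j < i then a i j else 0) := by
    intro i j
    rcases lt_trichotomy i j with h | rfl | h
    · rw [if_pos h, if_neg h.not_gt, add_zero]
    · rw [ha, if_neg (lt_irrefl _), add_zero]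
    · rw [if_pos h, if_neg h.not_gt, zero_add]
  have h2 : ∀ i j, (if i < j then a i j + a j i else 0) =
      (if i < j then a i j else 0) + (if i < j then a j i else 0) := by
    intro i j
    split_ifs <;> simp
  simp only [h2, Finset.sum_add_distrib]
  conv_lhs =>
    enter [2, i, 2, j]
    rw [h1]
  simp only [Finset.sum_add_distrib]
  congr 1
  exact Finset.sum_comm

/-- An element `x` of `𝔤` is determined modulo maps into `Rad(Q)` by the alternating form `β(xv,
w)`, which a combination of wedges of dual vectors reproduces. A map with values and zeros along
`Rad(Q)` is a sum of wedges having one factor in `Rad(Q)`. -/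
theorem orthLie_le_of_wedge_mem [FiniteDimensional k V] {S : Submodule k (Module.End k V)}
    (hS : ∀ v w, wedge Q v w ∈ S) : orthLie Q ≤ S := by
  intro x hx
  obtain ⟨C, hC⟩ := (LinearMap.ker Q.polarBilin).exists_isCompl
  let p : V →ₗ[k] C := Submodule.projectionOnto C _ hC.symm
  let b := Module.finBasis k C
  have hp : ∀ v, Q.polarBilin v = 0 → p v = 0 := fun v hv =>
    (Submodule.projectionOnto_apply_eq_zero_iff hC.symm).2 hv
  have hφ : ∀ i, ∃ f, Q.polarBilin f = b.coord i ∘ₗ p := fun i =>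
    exists_eq_of_vanish_on_ker _ (polarBilin_symm Q) _ fun v hv => by
      rw [LinearMap.comp_apply, hp v hv, map_zero]
  choose f hf using hφ
  have hsum : ∀ v, Q.polarBilin (v - ∑ i, Q.polarBilin (f i) v • (b i : V)) = 0 := by
    intro v
    have h1 : ∑ i, Q.polarBilin (f i) v • (b i : V) = p v := by
      conv_rhs => rw [← b.sum_repr (p v)]
      rw [Submodule.coe_sum]
      refine Finset.sum_congr rfl fun i _ => ?_
      rw [hf]
      rfl
    have h2 : p (v - p v) = 0 := by
      rw [map_sub, Submodule.projectionOnto_apply_left hC.symm, sub_self]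
    rw [h1]
    exact (Submodule.projectionOnto_apply_eq_zero_iff hC.symm).1 h2
  have expand : ∀ y : Module.End k V, (∀ v, Q.polarBilin v = 0 → y v = 0) → ∀ v,
      y v = ∑ i, Q.polarBilin (f i) v • y (b i) := by
    intro y hy v
    have := hy _ (hsum v)
    rw [map_sub, map_sum, sub_eq_zero] at this
    simpa only [map_smul] using this
  have hskew : ∀ v w, Q.polarBilin (x v) w = -Q.polarBilin (x w) v := by
    intro v w
    have := hx.1 (v + w)
    rw [map_add, map_add, map_add, LinearMap.add_apply, LinearMap.add_apply, hx.1, hx.1] at this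
    linear_combination this
  -- Summing over `i < j` avoids division by 2; the diagonal terms vanish because `β(xv, v) = 0`.
  let x' : Module.End k V := ∑ i, ∑ j, if i < j then
    Q.polarBilin (x (b i)) (b j) • wedge Q (f j) (f i) else 0
  have hx'S : x' ∈ S := Submodule.sum_mem _ fun i _ => Submodule.sum_mem _ fun j _ => by
    split_ifs
    · exact Submodule.smul_mem _ _ (hS _ _)
    · exact zero_mem _
  have hx'mem : x' ∈ orthLie Q := Submodule.sum_mem _ fun i _ => Submodule.sum_mem _ fun j _ => by
    split_ifs
    · exact Submodule.smul_mem _ _ (wedge_mem_orthLie _ _)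
    · exact zero_mem _
  have hd : ∀ v, Q.polarBilin ((x - x') v) = 0 := by
    intro v
    ext w
    have h1 : Q.polarBilin (x v) w = ∑ i, ∑ j,
        Q.polarBilin (f i) v * Q.polarBilin (f j) w * Q.polarBilin (x (b i)) (b j) := by
      rw [expand x (fun v hv => hx.2 v hv) v, map_sum, LinearMap.sum_apply]
      refine Finset.sum_congr rfl fun i _ => ?_
      rw [map_smul, LinearMap.smul_apply, hskew, expand x (fun v hv => hx.2 v hv) w, map_sum,
        LinearMap.sum_apply, smul_eq_mul, ← Finset.sum_neg_distrib, Finset.mul_sum]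
      refine Finset.sum_congr rfl fun j _ => ?_
      rw [map_smul, LinearMap.smul_apply, hskew (b j), smul_eq_mul]
      ring
    rw [LinearMap.sub_apply, map_sub, LinearMap.sub_apply, h1, sum_sum_eq_sum_sum_ite _
      (fun i => by rw [hx.1, mul_zero]), LinearMap.zero_apply, sub_eq_zero]
    simp only [x', LinearMap.sum_apply, map_sum]
    refine Finset.sum_congr rfl fun i _ => Finset.sum_congr rfl fun j _ => ?_
    split_ifs
    · rw [LinearMap.smul_apply, wedge_apply, map_smul, map_sub, map_smul, map_smul,
        LinearMap.smul_apply, LinearMap.sub_apply, LinearMap.smul_apply, LinearMap.smul_apply,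
        hskew (b j) (b i)]
      simp only [smul_eq_mul]
      ring
    · simp
  have hdS : x - x' = ∑ i, wedge Q ((x - x') (b i)) (f i) := by
    ext v
    rw [expand (x - x') (fun v hv => (sub_mem hx hx'mem).2 v hv) v, LinearMap.sum_apply]
    refine Finset.sum_congr rfl fun i _ => ?_
    rw [wedge_apply, hd, LinearMap.zero_apply, zero_smul, sub_zero]
  have : x - x' ∈ S := hdS ▸ Submodule.sum_mem _ fun i _ => hS _ _
  rw [← sub_add_cancel x x']
  exact add_mem this hx'S

theorem dual_ext_wedge [FiniteDimensional k V] {ξ ξ' : Module.Dual k (orthLie Q)}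
    (h : ∀ v w, ξ ⟨wedge Q v w, wedge_mem_orthLie v w⟩ =
      ξ' ⟨wedge Q v w, wedge_mem_orthLie v w⟩) : ξ = ξ' := by
  obtain ⟨F, hF⟩ := LinearMap.exists_extend (ξ - ξ')
  have hF' : ∀ x : orthLie Q, F x = ξ x - ξ' x := fun x => LinearMap.congr_fun hF x
  have := orthLie_le_of_wedge_mem (Q := Q) (S := LinearMap.ker F) fun v w => by
    rw [LinearMap.mem_ker, hF' ⟨wedge Q v w, wedge_mem_orthLie v w⟩, h, sub_self]
  ext x
  have h1 : F x = 0 := this x.2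
  rw [hF'] at h1
  exact sub_eq_zero.1 h1

theorem conj_wedge {g : V ≃ₗ[k] V} (hg : ∀ v, Q (g v) = Q v) (v w : V) :
    g.conj (wedge Q v w) = wedge Q (g v) (g w) := by
  ext u
  rw [LinearEquiv.conj_apply_apply, wedge_apply, wedge_apply, map_sub, map_smul, map_smul,
    polarBilin_symm_map hg, polarBilin_symm_map hg]

/-- Conjugation by `g` sends `v ∧ w` to `gv ∧ gw`, and a linear form on `𝔤` is determined by its
values on wedges. -/
theorem mem_coadjointCentralizer_iff [FiniteDimensional k V] (ξ : Module.Dual k (orthLie Q))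
    (g : SO Q) : g ∈ coadjointCentralizer Q ξ ↔
      ∀ v w, formOfDual Q ξ ((g : V ≃ₗ[k] V) v) ((g : V ≃ₗ[k] V) w) = formOfDual Q ξ v w := by
  have key : ∀ v w, ((Ad Q).dual g ξ) ⟨wedge Q ((g : V ≃ₗ[k] V) v) ((g : V ≃ₗ[k] V) w),
      wedge_mem_orthLie _ _⟩ = formOfDual Q ξ v w := by
    intro v w
    rw [formOfDual_apply]
    change ξ (Ad Q g⁻¹ _) = _
    congr 1
    refine Subtype.ext ?_
    change ((g⁻¹ : SO Q) : V ≃ₗ[k] V).conj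
      (wedge Q ((g : V ≃ₗ[k] V) v) ((g : V ≃ₗ[k] V) w)) = _
    rw [conj_wedge (g⁻¹).2.1]
    congr 1
    · congr 1
      exact (g : V ≃ₗ[k] V).symm_apply_apply v
    · exact (g : V ≃ₗ[k] V).symm_apply_apply w
  constructor
  · intro h v w
    have h' : (Ad Q).dual g ξ = ξ := h
    rw [← key v w, h', formOfDual_apply]
  · intro h
    change (Ad Q).dual g ξ = ξ
    refine dual_ext_wedge fun v w => ?_
    have h1 := key ((g : V ≃ₗ[k] V).symm v) ((g : V ≃ₗ[k] V).symm w)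
    rw [← h] at h1
    simp only [LinearEquiv.apply_symm_apply] at h1
    rw [h1, formOfDual_apply]

variable {𝒱 : ℤ → Submodule k V} [DirectSum.Decomposition 𝒱]

theorem conj_cocharacter_eq_iff (x : Module.End k V) (r s : kˣ) :
    (cocharacter 𝒱 r).conj x = s • x ↔
      ∀ u, cocharacter 𝒱 r (x u) = s • x (cocharacter 𝒱 r u) := by
  constructor
  · intro h u
    have := LinearMap.congr_fun h (cocharacter 𝒱 r u)
    rwa [LinearEquiv.conj_apply_apply, LinearEquiv.symm_apply_apply] at this
  · intro h
    ext u
    rw [LinearEquiv.conj_apply_apply, h, LinearEquiv.apply_symm_apply]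
    rfl

theorem conj_cocharacter_wedge (h𝒱 : IsOGood Q 𝒱) (r : kˣ) {a b : ℤ} {v w : V} (hv : v ∈ 𝒱 a)
    (hw : w ∈ 𝒱 b) :
    (cocharacter 𝒱 r).conj (wedge Q v w) = (r ^ (a + b) : kˣ) • wedge Q v w := by
  rw [conj_cocharacter_eq_iff]
  refine LinearMap.congr_fun (linearMap_ext_of_homogeneous (𝒱 := 𝒱)
    ((cocharacter 𝒱 r : V →ₗ[k] V) ∘ₗ wedge Q v w)
    (((r ^ (a + b) : kˣ) : k) • (wedge Q v w ∘ₗ (cocharacter 𝒱 r : V →ₗ[k] V)))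
    fun c u hu => ?_)
  simp only [LinearMap.comp_apply, LinearMap.smul_apply, LinearEquiv.coe_coe]
  rw [cocharacter_apply 𝒱 r hu, Units.smul_def, map_smul, wedge_apply, map_sub, map_smul, map_smul,
    cocharacter_apply 𝒱 r hv, cocharacter_apply 𝒱 r hw, smul_sub, smul_sub, Units.smul_def,
    Units.smul_def]
  congr 1
  · by_cases h : b + c = 0
    · obtain rfl : c = -b := by omega
      simp only [smul_smul]
      congr 1
      have : ((r ^ (a + b) : kˣ) : k) * ((r ^ (-b) : kˣ) : k) = ((r ^ a : kˣ) : k) := by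
        rw [← Units.val_mul, ← zpow_add, add_neg_cancel_right]
      rw [← this]
      ring
    · rw [h𝒱.orthogonal b c h w hw u hu]
      simp
  · by_cases h : a + c = 0
    · obtain rfl : c = -a := by omega
      simp only [smul_smul]
      congr 1
      have : ((r ^ (a + b) : kˣ) : k) * ((r ^ (-a) : kˣ) : k) = ((r ^ b : kˣ) : k) := by
        rw [← Units.val_mul, ← zpow_add]
        congr 2
        ring
      rw [← this]
      ring
    · rw [h𝒱.orthogonal a c h v hv u hu]
      simp

theorem exists_zpow_ne_one [IsAlgClosed k] {m : ℤ} (hm : m ≠ 0) : ∃ r : kˣ, r ^ m ≠ 1 := by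
  classical
  have : Infinite k := IsAlgClosed.instInfinite
  obtain ⟨c, hc⟩ := Infinite.exists_notMem_finset ({0, 1} : Finset k)
  simp only [Finset.mem_insert, Finset.mem_singleton, not_or] at hc
  obtain ⟨z, hz⟩ := IsAlgClosed.exists_pow_nat_eq c (Int.natAbs_pos.2 hm)
  have hz0 : z ≠ 0 := by
    rintro rfl
    rw [zero_pow (Int.natAbs_ne_zero.2 hm)] at hz
    exact hc.1 hz.symm
  refine ⟨Units.mk0 z hz0, fun h => hc.2 ?_⟩
  have h1 : (Units.mk0 z hz0) ^ m.natAbs = 1 := by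
    rcases Int.natAbs_eq m with h2 | h2
    · rw [← zpow_natCast, ← h2, h]
    · rw [h2, zpow_neg, zpow_natCast, inv_eq_one] at h
      exact h
  rw [← hz, ← Units.val_mk0 hz0, ← Units.val_pow_eq_pow_val, h1, Units.val_one]

theorem mem_dualGradedPiece_two_iff [IsAlgClosed k] [FiniteDimensional k V]
    (h𝒱 : IsOGood Q 𝒱) (ξ : Module.Dual k (orthLie Q)) :
    ξ ∈ dualGradedPiece Q 𝒱 2 ↔ formOfDual Q ξ ∈ formsTwo 𝒱 := by
  rw [dualGradedPiece, Submodule.mem_dualAnnihilator]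
  constructor
  · intro h
    refine ⟨formOfDual_isAlt ξ, fun a b hab v hv w hw => ?_⟩
    rw [formOfDual_apply]
    refine h _ (Submodule.mem_iSup_of_mem (a + b) (Submodule.mem_iSup_of_mem hab ?_))
    exact fun r => conj_cocharacter_wedge h𝒱 r hv hw
  · intro h
    suffices hle : (⨆ i : ℤ, ⨆ _ : i ≠ -2, gradedPiece Q 𝒱 i) ≤ LinearMap.ker ξ from
      fun x hx => hle hx
    refine iSup_le fun i => iSup_le fun hi x hx => ?_
    obtain ⟨X, hX⟩ := exists_trace_eq Q ξ
    obtain ⟨r, hr⟩ := exists_zpow_ne_one (k := k) (m := i + 2) (by omega)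
    -- No decomposition of `𝔤` is needed: `F` vanishes on all wedges, hence on `𝔤`, and on `𝔤_i` it
    -- is `r^i - r^{-2}` times `ξ`, a nonzero factor by the choice of `r`.
    let F : Module.Dual k (Module.End k V) := LinearMap.trace k V ∘ₗ
      LinearMap.mulLeft k X ∘ₗ ((cocharacter 𝒱 r).conj.toLinearMap -
        ((r ^ (-2 : ℤ) : kˣ) : k) • LinearMap.id)
    have hF : ∀ x, F x = LinearMap.trace k V (X * (cocharacter 𝒱 r).conj x) -
        ((r ^ (-2 : ℤ) : kˣ) : k) * LinearMap.trace k V (X * x) := by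
      intro x
      simp [F, mul_sub]
    have hF0 : ∀ v w, F (wedge Q v w) = 0 := by
      have h2 : (wedge Q).compr₂ F = 0 := by
        refine linearMap_ext_of_homogeneous (𝒱 := 𝒱) _ _ fun a v hv =>
          linearMap_ext_of_homogeneous (𝒱 := 𝒱) _ _ fun b w hw => ?_
        change F (wedge Q v w) = 0
        rw [hF, conj_cocharacter_wedge h𝒱 r hv hw, Units.smul_def, mul_smul_comm, map_smul,
          trace_mul_wedge, ← formOfDual_eq Q ξ X hX, smul_eq_mul]
        by_cases hab : a + b = -2
        · rw [hab, sub_self]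
        · rw [h.2 a b hab v hv w hw]
          simp
      exact fun v w => LinearMap.congr_fun₂ h2 v w
    have h1 : F x = 0 := orthLie_le_of_wedge_mem (S := LinearMap.ker F) hF0 x.2
    rw [hF, hx r, Units.smul_def, mul_smul_comm, map_smul, ← hX, smul_eq_mul, ← sub_mul,
      mul_eq_zero, sub_eq_zero, Units.val_inj] at h1
    refine h1.resolve_left fun h3 => hr ?_
    rw [zpow_add, h3, ← zpow_add, neg_add_cancel, zpow_zero]

end Coadjoint

/-! ### Stabilizing isometries that lower degrees -/

section Necessity

theorem det_one_add_of_isNilpotent [FiniteDimensional k V] {N : Module.End k V}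
    (hN : IsNilpotent N) : LinearMap.det (1 + N) = 1 := by
  have h := LinearMap.eval_charpoly (-N) (1 : k)
  rw [hN.neg.charpoly_eq_X_pow_finrank, map_one, sub_neg_eq_add] at h
  rw [← h]
  simp

theorem exists_linearEquiv_one_add [FiniteDimensional k V] {N : Module.End k V}
    (hN : IsNilpotent N) : ∃ g : V ≃ₗ[k] V, (∀ v, g v = v + N v) ∧
      LinearMap.det (g : V →ₗ[k] V) = 1 := by
  have hdet := det_one_add_of_isNilpotent hN
  let g : V ≃ₗ[k] V := LinearMap.equivOfDetNeZero (1 + N) (by rw [hdet]; exact one_ne_zero)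
  have hg : (g : V →ₗ[k] V) = 1 + N := by
    ext v
    rfl
  exact ⟨g, fun v => LinearMap.congr_fun hg v, hg ▸ hdet⟩

/-- The stabilizer in `SO(V)` of the form `η` preserves the filtration of `V`. -/
def StabilizerPreserves (Q : QuadraticForm k V) (𝒱 : ℤ → Submodule k V)
    (η : LinearMap.BilinForm k V) : Prop :=
  ∀ g ∈ SO Q, (∀ v w, η (g v) (g w) = η v w) →
    ∀ a, (filtration 𝒱 a).map (g : V →ₗ[k] V) = filtration 𝒱 a

variable {Q : QuadraticForm k V} {𝒱 : ℤ → Submodule k V}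
  {η : LinearMap.BilinForm k V} {A : Module.End k V}

theorem isotropic_span {T : Set V} (hTQ : ∀ x ∈ T, Q x = 0)
    (hT : ∀ x ∈ T, ∀ y ∈ T, Q.polarBilin x y = 0) {x : V} (hx : x ∈ Submodule.span k T) :
    Q x = 0 ∧ ∀ y ∈ T, Q.polarBilin x y = 0 := by
  have h1 : ∀ z ∈ Submodule.span k T, ∀ y ∈ T, Q.polarBilin y z = 0 := by
    intro z hz y hy
    have hle : Submodule.span k T ≤ LinearMap.ker (Q.polarBilin y) :=
      Submodule.span_le.2 fun t ht => hT y hy t ht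
    exact hle hz
  have h2 : ∀ z ∈ Submodule.span k T, ∀ y ∈ Submodule.span k T, Q.polarBilin z y = 0 := by
    intro z hz y hy
    have hle : Submodule.span k T ≤ LinearMap.ker (Q.polarBilin z) :=
      Submodule.span_le.2 fun t ht => by
        change Q.polarBilin z t = 0
        rw [polarBilin_symm]
        exact h1 z hz t ht
    exact hle hy
  refine ⟨?_, fun y hy => h2 x hx y (Submodule.subset_span hy)⟩
  induction hx using Submodule.span_induction with
  | mem x hx => exact hTQ x hx
  | zero => exact QuadraticMap.map_zero Q
  | add x y hx hy ihx ihy => rw [map_add_polarBilin, ihx, ihy, h2 x hx y hy, add_zero, add_zero]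
  | smul c x _ ih => rw [QuadraticMap.map_smul, ih, smul_zero]

/-- The two terms on the right have the same shape, shifted by one link; with alternating signs
along two opposite chains they telescope. -/
theorem form_wedge_add (hη : η.IsAlt) {p p' r r' : V} (hp : η p = Q.polarBilin p')
    (hr : η r' = Q.polarBilin r) (v w : V) :
    η (wedge Q p r' v) w + η v (wedge Q p r' w) =
      Q.polarBilin (wedge Q p r v) w + Q.polarBilin (wedge Q p' r' v) w := by
  rw [form_swap hη v]
  simp only [wedge_apply, map_sub, map_smul, LinearMap.sub_apply, LinearMap.smul_apply, hp, hr,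
    smul_eq_mul]
  ring

theorem exists_mem_ne_zero_of_map_ne [FiniteDimensional k V] {p q : Submodule k V}
    (hle : p.map A ≤ q) (hne : p.map A ≠ q)
    (hdim : Module.finrank k q ≤ Module.finrank k p) : ∃ w ∈ p, w ≠ 0 ∧ A w = 0 := by
  by_contra! hcon
  have hinj : Function.Injective (A ∘ₗ p.subtype) := by
    rw [injective_iff_map_eq_zero]
    intro w hw
    by_contra hw0
    exact hcon w w.2 (fun h => hw0 (Subtype.ext h)) hw
  have h1 := LinearMap.finrank_range_of_inj hinj
  rw [LinearMap.range_comp, Submodule.range_subtype] at h1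
  exact hne (Submodule.eq_of_le_of_finrank_le hle (by omega))

variable [DirectSum.Decomposition 𝒱]

theorem homComponent_eq_zero_of_stabilizer [FiniteDimensional k V]
    (H : StabilizerPreserves Q 𝒱 η) {N : Module.End k V} (hN : IsNilpotent N)
    (hNQ : ∀ v, Q (v + N v) = Q v) (hNη : ∀ v w, η (v + N v) (w + N w) = η v w) {a b : ℤ}
    (hab : b < a) {v : V} (hv : v ∈ 𝒱 a) : homComponent 𝒱 b (N v) = 0 := by
  obtain ⟨g, hg, hdet⟩ := exists_linearEquiv_one_add hN
  have h1 := H g ⟨fun v => by rw [hg, hNQ], hdet⟩ (fun v w => by rw [hg, hg, hNη]) a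
  have h2 : g v ∈ filtration 𝒱 a := by
    rw [← h1]
    exact ⟨v, mem_filtration_of_mem le_rfl hv, rfl⟩
  have h3 := mem_filtration_iff.1 h2 b hab
  rwa [hg, map_add, homComponent_ne hab.ne' hv, zero_add] at h3

/-- The Siegel transformation of the singular vector `u` and of `w` is a unipotent isometry. It
fixes `η` because `1 + N` differs from the identity by vectors in the radical of `η`. The quadratic
term allows `w` to be nonsingular, as it may be in `V^0`. -/
theorem homComponent_siegel_eq_zero [FiniteDimensional k V]
    (H : StabilizerPreserves Q 𝒱 η) (hη : η.IsAlt) {u w : V}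
    (hu : Q u = 0) (huw : Q.polarBilin u w = 0) (hηu : η u = 0) (hηw : η w = 0) {a b : ℤ}
    (hab : b < a) {v : V} (hv : v ∈ 𝒱 a) :
    homComponent 𝒱 b (Q.polarBilin u v • w - Q.polarBilin w v • u -
      (Q w * Q.polarBilin u v) • u) = 0 := by
  let N : Module.End k V := wedge Q w u - Q w • (Q.polarBilin u).smulRight u
  have hN : ∀ v, N v = Q.polarBilin u v • w - Q.polarBilin w v • u -
      (Q w * Q.polarBilin u v) • u := fun v => by
    simp [N, wedge_apply, mul_smul]
  have huu : Q.polarBilin u u = 0 := by rw [polarBilin_self, hu, mul_zero]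
  have hwu : Q.polarBilin w u = 0 := by rw [polarBilin_symm, huw]
  have hNu : N u = 0 := by rw [hN, huu, hwu]; simp
  have hNw : N w = -(Q.polarBilin w w • u) := by rw [hN, huw]; simp
  have hnil : IsNilpotent N := by
    refine ⟨3, ?_⟩
    ext v
    rw [pow_succ, pow_two, Module.End.mul_apply, Module.End.mul_apply, hN v]
    simp [hNu, hNw]
  have hηr : ∀ x, η x u = 0 ∧ η x w = 0 := fun x => by
    rw [form_swap hη x u, form_swap hη x w, hηu, hηw]
    simp
  rw [← hN]
  refine homComponent_eq_zero_of_stabilizer H hnil (fun v => ?_) (fun x y => ?_) hab hv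
  · have hvu : Q.polarBilin v u = Q.polarBilin u v := polarBilin_symm Q v u
    have hvw : Q.polarBilin v w = Q.polarBilin w v := polarBilin_symm Q v w
    have e : N v = Q.polarBilin u v • w +
        (-(Q.polarBilin w v + Q w * Q.polarBilin u v)) • u := by
      rw [hN]
      module
    rw [e, map_add_polarBilin, map_add_polarBilin, QuadraticMap.map_smul, QuadraticMap.map_smul, hu]
    simp only [map_add, map_smul, LinearMap.smul_apply, smul_eq_mul, hwu, hvu, hvw]
    ring
  · rw [hN, hN]
    simp [hηu, hηw, hηr]

/-- If surjectivity fails, `dim V^a ≥ dim V^{a+2}` gives `w ≠ 0` in `V^a` with `Aw = 0`, and duality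
gives `u` in `V^{-a-2}` orthogonal to `A V^a` but not to some `t ∈ V^{a+2}`. Both lie in the radical
of `η`, and their Siegel transformation moves `t` by `β(u, t) w` in the lower degree `a`. -/
theorem map_eq_of_stabilizer [FiniteDimensional k V] (hA : IsRaisingMap Q 𝒱 η A)
    (hQ : Q.Nondegenerate) (h𝒱 : IsOGood Q 𝒱) (hη : η ∈ formsTwo 𝒱)
    (H : StabilizerPreserves Q 𝒱 η) {a : ℤ} (ha : 0 ≤ a) : (𝒱 a).map A = 𝒱 (a + 2) := by
  by_contra hne
  have hle : (𝒱 a).map A ≤ 𝒱 (a + 2) := by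
    rintro _ ⟨x, hx, rfl⟩
    exact hA.map_mem a (by omega) x hx
  obtain ⟨w, hw, hw0, hAw⟩ := exists_mem_ne_zero_of_map_ne hle hne (by
    have h1 := h𝒱.finrank_le a ha
    rw [← finrank_neg_eq h𝒱 a, finrank_neg_eq h𝒱 (-a - 2)] at h1
    rwa [show -(-a - 2) = a + 2 by ring] at h1)
  obtain ⟨t, ht, ht'⟩ : ∃ t ∈ 𝒱 (a + 2), t ∉ (𝒱 a).map A := by
    by_contra! hcon
    exact hne (le_antisymm hle hcon)
  obtain ⟨f, hft, hf⟩ := Submodule.exists_le_ker_of_notMem ht'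
  obtain ⟨u, hu, huf⟩ := exists_polarBilin_eq hQ h𝒱 (b := a + 2) (by omega) f
  have hηu : η u = 0 := by
    ext z
    have e : -(-(a + 2)) - 2 = a := by ring
    rw [form_eq_homComponent hη hu, e, form_swap hη.1,
      hA.polarBilin_eq h𝒱 hη (by omega) (homComponent_mem 𝒱 a z), polarBilin_symm,
      huf _ (hA.map_mem a (by omega) _ (homComponent_mem 𝒱 a z))]
    have : f (A (homComponent 𝒱 a z)) = 0 := hf ⟨_, homComponent_mem 𝒱 a z, rfl⟩
    rw [this]
    simp
  have hηw : η w = 0 := by rw [hA.polarBilin_eq h𝒱 hη (by omega) hw, hAw, map_zero]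
  have h1 := homComponent_siegel_eq_zero H hη.1 (h𝒱.isotropic _ (by omega) u hu)
    (h𝒱.orthogonal _ _ (by omega) u hu w hw) hηu hηw (b := a) (by omega) ht
  rw [map_sub, map_sub, map_smul, map_smul, map_smul, homComponent_same hw,
    homComponent_ne (by omega) hu, smul_zero, smul_zero, sub_zero, sub_zero, huf t ht,
    smul_eq_zero] at h1
  exact h1.elim hft hw0

/-- A sum of endomorphisms `p_i ∧ r_{i+1}` along two chains running in opposite directions,
supported on a totally singular subspace, annihilates the form infinitesimally; adding the
identity gives a stabilizing isometry. -/
theorem homComponent_sum_wedge_eq_zero [FiniteDimensional k V] (H : StabilizerPreserves Q 𝒱 η)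
    (hη : η.IsAlt) {L : ℕ} {p r : ℕ → V} {T : Set V} (hTQ : ∀ x ∈ T, Q x = 0)
    (hT : ∀ x ∈ T, ∀ y ∈ T, Q.polarBilin x y = 0) (hpT : ∀ i ≤ L, p i ∈ T)
    (hrT : ∀ i ≤ L, r i ∈ T) (hp : ∀ i < L, η (p i) = Q.polarBilin (p (i + 1)))
    (hr : ∀ i < L, η (r (i + 1)) = Q.polarBilin (r i)) (h0 : wedge Q (p 0) (r 0) = 0)
    (hL : wedge Q (p L) (r L) = 0) {a b : ℤ} (hab : b < a) {v : V} (hv : v ∈ 𝒱 a) :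
    homComponent 𝒱 b (∑ i ∈ Finset.range L,
      ((-1 : k) ^ i) • wedge Q (p i) (r (i + 1)) v) = 0 := by
  let N : Module.End k V := ∑ i ∈ Finset.range L, ((-1 : k) ^ i) • wedge Q (p i) (r (i + 1))
  have hN : ∀ v, N v = ∑ i ∈ Finset.range L, ((-1 : k) ^ i) • wedge Q (p i) (r (i + 1)) v :=
    fun v => by simp [N, LinearMap.sum_apply]
  have hNspan : ∀ v, N v ∈ Submodule.span k T := fun v => by
    rw [hN]
    refine Submodule.sum_mem _ fun i hi => Submodule.smul_mem _ _ ?_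
    rw [Finset.mem_range] at hi
    rw [wedge_apply]
    exact sub_mem (Submodule.smul_mem _ _ (Submodule.subset_span (hpT i hi.le)))
      (Submodule.smul_mem _ _ (Submodule.subset_span (hrT (i + 1) hi)))
  have hNmem : N ∈ orthLie Q := Submodule.sum_mem _ fun i _ =>
    Submodule.smul_mem _ _ (wedge_mem_orthLie _ _)
  have hNT : ∀ v, ∀ y ∈ T, Q.polarBilin y (N v) = 0 := fun v y hy => by
    rw [polarBilin_symm]
    exact (isotropic_span hTQ hT (hNspan v)).2 y hy
  have hnil : IsNilpotent N := by
    refine ⟨2, ?_⟩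
    ext v
    rw [pow_two, Module.End.mul_apply, hN (N v), LinearMap.zero_apply]
    refine Finset.sum_eq_zero fun i hi => ?_
    rw [Finset.mem_range] at hi
    rw [wedge_apply, hNT v _ (hpT i hi.le), hNT v _ (hrT (i + 1) hi)]
    simp
  have hinf : ∀ v w, η (N v) w + η v (N w) = 0 := by
    intro v w
    -- By `form_wedge_add` the sum telescopes to `t L - t 0`, and both ends vanish by `h0` and `hL`.
    let t : ℕ → k := fun i => -((-1) ^ i * Q.polarBilin (wedge Q (p i) (r i) v) w)
    have h1 : η (N v) w + η v (N w) = ∑ i ∈ Finset.range L, (t (i + 1) - t i) := by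
      rw [hN, hN, map_sum, map_sum, LinearMap.sum_apply, ← Finset.sum_add_distrib]
      refine Finset.sum_congr rfl fun i hi => ?_
      rw [Finset.mem_range] at hi
      rw [map_smul, map_smul, LinearMap.smul_apply, ← smul_add,
        form_wedge_add hη (hp i hi) (hr i hi)]
      simp only [t, smul_eq_mul]
      ring
    rw [h1, Finset.sum_range_sub]
    simp [t, h0, hL]
  have hquad : ∀ v w, η (N v) (N w) = 0 := by
    intro v w
    rw [hN v, map_sum, LinearMap.sum_apply]
    refine Finset.sum_eq_zero fun i hi => ?_
    rw [Finset.mem_range] at hi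
    rw [map_smul, LinearMap.smul_apply, wedge_apply, map_sub, LinearMap.sub_apply, map_smul,
      map_smul, LinearMap.smul_apply, LinearMap.smul_apply, hp i hi, hr i hi,
      hNT w _ (hpT (i + 1) hi), hNT w _ (hrT i hi.le)]
    simp
  rw [← hN]
  refine homComponent_eq_zero_of_stabilizer H hnil (fun v => ?_) (fun x y => ?_) hab hv
  · rw [map_add_polarBilin, (isotropic_span hTQ hT (hNspan v)).1, polarBilin_symm, hNmem.1]
    simp
  · simp only [map_add, LinearMap.add_apply]
    rw [hquad]
    linear_combination hinf x y

/-- The chain through `u` spans a totally singular space. Its two halves, read outwards from `u`,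
give the opposite chains for `homComponent_sum_wedge_eq_zero`: they start with `u ∧ u = 0` and stop
at `A^n u = 0`. -/
theorem eq_zero_of_stabilizer_of_mem_zero [FiniteDimensional k V] (hA : IsRaisingMap Q 𝒱 η A)
    (hQ : Q.Nondegenerate) (h𝒱 : IsOGood Q 𝒱) (hη : η ∈ formsTwo 𝒱)
    (H : StabilizerPreserves Q 𝒱 η) {n : ℕ} (hn : 1 ≤ n) {u : V} (hu : u ∈ 𝒱 0)
    (hAu : (A ^ n) u = 0) (hQu : Q u = 0)
    (hu' : ∀ z ∈ 𝒱 0, (A ^ n) z = 0 → Q.polarBilin u z = 0) : u = 0 := by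
  obtain ⟨y, hyn, hyA, hy, hlink⟩ := exists_chain_of_mem_zero hA hQ h𝒱 hη hn hu hu'
  have hpair : ∀ i j : ℕ, n ≤ i → Q.polarBilin (y i) (y j) = 0 := by
    intro i j hi
    by_cases hij : i + j = 2 * n
    -- In complementary degrees, moving the links back to the middle reduces the pairing to `β(u, u)
    -- = 2 Q(u) = 0`.
    · obtain ⟨d, rfl⟩ := Nat.exists_eq_add_of_le hi
      have h1 := polarBilin_chain hA h𝒱 hη (y := fun i => y (j + i)) (n := d)
        (fun i _ => hlink (j + i)) (c := 0) (fun i _ => by omega) hu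
      have e : j + d = n := by omega
      simp only [e, hyn, add_zero] at h1
      rw [polarBilin_self, hQu, mul_zero, eq_comm, mul_eq_zero] at h1
      rw [hyA]
      exact h1.resolve_left (by simp)
    · exact h𝒱.orthogonal _ _ (by omega) _ (hy i) _ (hy j)
  have key := fun v hv => homComponent_sum_wedge_eq_zero H hη.1 (L := n)
    (p := fun i => y (n + i)) (r := fun i => y (n - i)) (T := Set.range y)
    (by
      rintro _ ⟨i, rfl⟩
      by_cases hi : i = n
      · rw [hi, hyn, hQu]
      · exact h𝒱.isotropic _ (by omega) _ (hy i))
    (by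
      rintro _ ⟨i, rfl⟩ _ ⟨j, rfl⟩
      rcases le_or_gt n i with hi | hi
      · exact hpair i j hi
      · rcases le_or_gt n j with hj | hj
        · rw [polarBilin_symm]
          exact hpair j i hj
        · exact h𝒱.orthogonal _ _ (by omega) _ (hy i) _ (hy j))
    (fun i _ => ⟨_, rfl⟩) (fun i _ => ⟨_, rfl⟩) (fun i _ => hlink (n + i))
    (fun i hi => by
      have e : n - i = n - (i + 1) + 1 := by omega
      rw [e]
      exact hlink _)
    (by
      ext v
      rw [wedge_apply]
      simp)
    (by
      ext v
      rw [wedge_apply, hyA, hAu]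
      simp)
    (a := 0) (b := -2) (by norm_num) (v := v) hv
  -- For `i > 0` both factors have nonzero degree and pair to zero with `V^0`, so only `u ∧ y (n -
  -- 1)` acts.
  have hsum : ∀ v ∈ 𝒱 0, (∑ i ∈ Finset.range n,
      ((-1 : k) ^ i) • wedge Q (y (n + i)) (y (n - (i + 1))) v) =
      -(Q.polarBilin u v • y (n - 1)) := by
    intro v hv
    rw [Finset.sum_eq_single_of_mem 0 (Finset.mem_range.2 hn)]
    · rw [wedge_apply, pow_zero, one_smul, add_zero, hyn, zero_add,
        h𝒱.orthogonal _ 0 (by omega) _ (hy (n - 1)) v hv, zero_smul, zero_sub]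
    · intro i hi hi0
      rw [Finset.mem_range] at hi
      rw [wedge_apply, h𝒱.orthogonal _ 0 (by omega) _ (hy (n + i)) v hv,
        h𝒱.orthogonal _ 0 (by omega) _ (hy (n - (i + 1))) v hv]
      simp
  have hylast : y (n - 1) ∈ 𝒱 (-2) := by
    convert hy (n - 1) using 2
    push_cast [Nat.cast_sub hn]
    ring
  have hlast : η (y (n - 1)) = Q.polarBilin u := by
    rw [hlink, Nat.sub_add_cancel hn, hyn]
  refine eq_zero_of_mem_ker hQ hQu ?_
  -- In either case `u` lies in `Rad(Q)`: through the link from `y (n - 1)` to `u`, or because `β(u,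
  -- v) y (n - 1) = 0` for all `v`.
  by_cases hy0 : y (n - 1) = 0
  · rw [← hlast, hy0, map_zero]
  · refine polarBilin_eq_zero_of_mem h𝒱 hu fun v hv => ?_
    rw [neg_zero] at hv
    have h1 := key v hv
    rw [hsum v hv, map_neg, neg_eq_zero, map_smul, homComponent_same hylast, smul_eq_zero] at h1
    exact h1.resolve_right hy0

/-- The two `A`-chains of `x` and `x'`, taken in opposite directions, give a nilpotent `N`. From
`V^1` to `V^{-1}` only its middle term `A^m x ∧ A^m x'` acts; it must vanish there, which forces
proportionality. -/
theorem exists_eq_smul_of_stabilizer [FiniteDimensional k V] (hA : IsRaisingMap Q 𝒱 η A)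
    (hQ : Q.Nondegenerate) (h𝒱 : IsOGood Q 𝒱) (hη : η ∈ formsTwo 𝒱)
    (H : StabilizerPreserves Q 𝒱 η) {m : ℕ} {x x' : V} (hx : x ∈ 𝒱 (-(1 + 2 * m)))
    (hx' : x' ∈ 𝒱 (-(1 + 2 * m))) (hAx : (A ^ (2 * m + 1)) x = 0)
    (hAx' : (A ^ (2 * m + 1)) x' = 0) (hne : (A ^ m) x ≠ 0) :
    ∃ c : k, (A ^ m) x' = c • (A ^ m) x := by
  have hodd : Odd (-(1 + 2 * (m : ℤ))) := by simp [parity_simps]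
  have hc : ∀ z ∈ 𝒱 (-(1 + 2 * m)), ∀ i : ℕ, (A ^ i) z ∈ 𝒱 (2 * i - 2 * m - 1) := fun z hz i => by
    convert (odd_chain hA h𝒱 hη hodd hz i).1 using 2
    ring
  have hl : ∀ z ∈ 𝒱 (-(1 + 2 * m)), ∀ i : ℕ, η ((A ^ i) z) = Q.polarBilin ((A ^ (i + 1)) z) :=
    fun z hz i => (odd_chain hA h𝒱 hη hodd hz i).2
  let S : Set V := {z | z ∈ 𝒱 (-(1 + 2 * m)) ∧ (A ^ (2 * m + 1)) z = 0}
  have hpair : ∀ z ∈ S, ∀ z' ∈ S, ∀ i j : ℕ,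
      Q.polarBilin ((A ^ i) z) ((A ^ j) z') = 0 := by
    intro z hz z' hz' i j
    by_cases hij : i + j = 2 * m + 1
    · rw [polarBilin_chain hA h𝒱 hη (y := fun i => (A ^ i) z) (fun i _ => hl z hz.1 i)
        (fun i _ => by omega) (hc z' hz'.1 j), ← Module.End.mul_apply, ← pow_add, hij, hz'.2]
      simp
    · exact h𝒱.orthogonal _ _ (by omega) _ (hc z hz.1 i) _ (hc z' hz'.1 j)
  have key := fun v hv => homComponent_sum_wedge_eq_zero H hη.1 (L := 2 * m + 1)
    (p := fun i => (A ^ i) x) (r := fun i => (A ^ (2 * m + 1 - i)) x')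
    (T := {t | ∃ z ∈ S, ∃ i : ℕ, (A ^ i) z = t})
    (by
      rintro _ ⟨z, hz, i, rfl⟩
      exact h𝒱.isotropic _ (by omega) _ (hc z hz.1 i))
    (by
      rintro _ ⟨z, hz, i, rfl⟩ _ ⟨z', hz', j, rfl⟩
      exact hpair z hz z' hz' i j)
    (fun i _ => ⟨x, ⟨hx, hAx⟩, i, rfl⟩) (fun i _ => ⟨x', ⟨hx', hAx'⟩, _, rfl⟩)
    (fun i _ => hl x hx i)
    (fun i hi => by
      have e : 2 * m + 1 - i = 2 * m + 1 - (i + 1) + 1 := by omega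
      rw [e]
      exact hl x' hx' _)
    (by
      rw [Nat.sub_zero, hAx', map_zero])
    (by
      rw [hAx, map_zero, LinearMap.zero_apply])
    (a := 1) (b := -1) (by norm_num) (v := v) hv
  have hum : ∀ z ∈ 𝒱 (-(1 + 2 * m)), (A ^ m) z ∈ 𝒱 (-1) := fun z hz => by
    convert hc z hz m using 2
    ring
  have hsum : ∀ v ∈ 𝒱 1, (∑ i ∈ Finset.range (2 * m + 1),
      ((-1 : k) ^ i) • wedge Q ((A ^ i) x) ((A ^ (2 * m + 1 - (i + 1))) x') v) =
      ((-1 : k) ^ m) • wedge Q ((A ^ m) x) ((A ^ m) x') v := by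
    intro v hv
    rw [Finset.sum_eq_single_of_mem m (Finset.mem_range.2 (by omega))]
    · have e : 2 * m + 1 - (m + 1) = m := by omega
      rw [e]
    · intro i hi him
      rw [Finset.mem_range] at hi
      rw [wedge_apply, h𝒱.orthogonal _ 1 (by omega) _ (hc x hx i) v hv,
        h𝒱.orthogonal _ 1 (by omega) _ (hc x' hx' _) v hv]
      simp
  obtain ⟨v, hv, hxv⟩ : ∃ v ∈ 𝒱 1, Q.polarBilin ((A ^ m) x) v ≠ 0 := by
    by_contra! hcon
    exact hne (eq_zero_of_polarBilin hQ h𝒱 (a := -1) (by norm_num) (hum x hx)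
      (by simpa using hcon))
  have h1 := key v hv
  rw [hsum v hv, map_smul, smul_eq_zero] at h1
  have h2 := h1.resolve_left (by simp)
  rw [wedge_apply, map_sub, map_smul, map_smul, homComponent_same (hum x hx),
    homComponent_same (hum x' hx'), sub_eq_zero] at h2
  refine ⟨Q.polarBilin ((A ^ m) x') v / Q.polarBilin ((A ^ m) x) v, ?_⟩
  rw [div_eq_inv_mul, mul_smul, h2, smul_smul, inv_mul_cancel₀ hxv, one_smul]

/-- By `exists_eq_smul_of_stabilizer` the radical of `η` on `W` has dimension at most 1. As `W` is
even-dimensional and `η` alternating, this dimension is even, hence 0. -/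
theorem eq_zero_of_stabilizer_of_mem_neg_one [FiniteDimensional k V]
    (hA : IsRaisingMap Q 𝒱 η A) (hQ : Q.Nondegenerate) (h𝒱 : IsOGood Q 𝒱)
    (hη : η ∈ formsTwo 𝒱) (H : StabilizerPreserves Q 𝒱 η) {W : Submodule k V}
    (heven : Even (Module.finrank k W)) {m : ℕ}
    (hlift : ∀ u ∈ W, (∀ z ∈ W, η u z = 0) →
      ∃ x ∈ 𝒱 (-(1 + 2 * m)), (A ^ m) x = u ∧ (A ^ (2 * m + 1)) x = 0)
    {u : V} (hu : u ∈ W) (hu' : ∀ z ∈ W, η u z = 0) : u = 0 := by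
  by_contra hu0
  have h1 := even_finrank_add_finrank_ker _ (η.restrict W) (fun p => hη.1 p) rfl
  rw [Nat.even_add] at h1
  have h2 := h1.1 heven
  have hmem : (⟨u, hu⟩ : W) ∈ LinearMap.ker (η.restrict W) :=
    LinearMap.ext fun z => hu' z z.2
  obtain ⟨x, hx, hxu, hAx⟩ := hlift u hu hu'
  have h3 : Module.finrank k (LinearMap.ker (η.restrict W)) ≤ 1 := by
    refine finrank_le_one ⟨⟨u, hu⟩, hmem⟩ fun t => ?_
    have ht : ∀ z ∈ W, η (t : W) z = 0 := fun z hz => LinearMap.congr_fun t.2 ⟨z, hz⟩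
    obtain ⟨x', hx', hxt, hAx'⟩ := hlift _ (t : W).2 ht
    obtain ⟨c, hc⟩ := exists_eq_smul_of_stabilizer hA hQ h𝒱 hη H hx hx' hAx hAx'
      (by rwa [hxu])
    rw [hxu, hxt] at hc
    exact ⟨c, Subtype.ext (Subtype.ext hc.symm)⟩
  have h4 : 0 < Module.finrank k (LinearMap.ker (η.restrict W)) := by
    rw [Module.finrank_pos_iff_exists_ne_zero]
    exact ⟨⟨⟨u, hu⟩, hmem⟩, fun h => hu0 (congrArg Subtype.val (congrArg Subtype.val h))⟩
  obtain ⟨d, hd⟩ := h2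
  omega

theorem mem_formsTwoZero_of_stabilizer [IsAlgClosed k] [FiniteDimensional k V]
    (hQ : Q.Nondegenerate) (h𝒱 : IsOGood Q 𝒱) (hη : η ∈ formsTwo 𝒱)
    (H : StabilizerPreserves Q 𝒱 η) : η ∈ formsTwoZero Q 𝒱 := by
  obtain ⟨A, hA, -⟩ := existsUnique_isRaisingMap hQ h𝒱 η
  have hform : ∀ x ∈ 𝒱 (-1), η x = Q.polarBilin (A x) := fun x hx =>
    hA.polarBilin_eq h𝒱 hη (by norm_num) hx
  have hmem : ∀ x ∈ 𝒱 (-1), A x ∈ 𝒱 1 := fun x hx => by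
    simpa using hA.map_mem (-1) (by norm_num) x hx
  -- Since `dim V^{-1} = dim V^1`, failure of surjectivity would give a kernel vector. It lies in
  -- the radical of `η` on `V^{-1}`, so the case `m = 0`, `W = V^{-1}` excludes it.
  have hneg : (𝒱 (-1)).map A = 𝒱 1 := by
    by_contra hne
    have hle : (𝒱 (-1)).map A ≤ 𝒱 1 := by
      rintro _ ⟨x, hx, rfl⟩
      exact hmem x hx
    obtain ⟨w, hw, hw0, hAw⟩ := exists_mem_ne_zero_of_map_ne hle hne (finrank_neg_eq h𝒱 1).le
    refine hw0 (eq_zero_of_stabilizer_of_mem_neg_one hA hQ h𝒱 hη H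
      (h𝒱.even_finrank (-1) (by decide)) (m := 0) (fun u hu hu' => ⟨u, by simpa using hu, rfl, ?_⟩)
      hw fun z _ => by rw [hform w hw, hAw, map_zero, LinearMap.zero_apply])
    rw [mul_zero, zero_add, pow_one]
    refine eq_zero_of_polarBilin hQ h𝒱 one_ne_zero (hmem u hu) fun z hz => ?_
    rw [← hform u hu]
    exact hu' z hz
  have hs1 : ∀ n : ℕ, (𝒱 (2 * n - 1)).map A = 𝒱 (2 * n + 1) := by
    intro n
    rcases Nat.eq_zero_or_pos n with rfl | hn
    · simpa using hneg
    · rw [map_eq_of_stabilizer hA hQ h𝒱 hη H (by omega)]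
      congr 1
      ring
  refine ⟨hη, A, hA, fun n => map_eq_of_stabilizer hA hQ h𝒱 hη H (by omega), fun n hn => ?_, hs1,
    fun n hn => ?_⟩
  · rw [nondegenerate_comp_subtype_iff]
    exact fun u hu hQu hu' => eq_zero_of_stabilizer_of_mem_zero hA hQ h𝒱 hη H hn hu.1 hu.2 hQu
      fun z hz hz' => hu' z ⟨hz, hz'⟩
  · obtain ⟨m, rfl⟩ : ∃ m, n = m + 1 := ⟨n - 1, by omega⟩
    have hsurj : ∀ v ∈ 𝒱 (2 * m + 1), ∃ z ∈ 𝒱 (-1), (A ^ (m + 1)) z = v := by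
      intro v hv
      refine exists_pow_eq_of_map_eq (𝒱 := 𝒱) (A := A) (c := -1) (fun i => ?_) (m + 1) v ?_
      · rw [show (-1 + 2 * (i : ℤ)) = 2 * i - 1 by ring, hs1 i]
        congr 1
        ring
      · convert hv using 2
        push_cast
        ring
    -- The kernel of a surjection from `V^{-1}` onto `V^{2m+1}`, both of even dimension.
    have heven : Even (Module.finrank k (𝒱 (-1) ⊓ (A ^ (m + 1)).ker : Submodule k V)) := by
      let f : 𝒱 (-1) →ₗ[k] V := (A ^ (m + 1)) ∘ₗ (𝒱 (-1)).subtype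
      have hrange : LinearMap.range f = 𝒱 (2 * m + 1) := by
        refine le_antisymm ?_ fun v hv => ?_
        · rintro _ ⟨x, rfl⟩
          have := hA.pow_mem (n := m + 1) (fun i _ => by omega) x.2
          rwa [show (-1 : ℤ) + 2 * ((m + 1 : ℕ) : ℤ) = 2 * m + 1 by push_cast; ring] at this
        · obtain ⟨z, hz, rfl⟩ := hsurj v hv
          exact ⟨⟨z, hz⟩, rfl⟩
      have hker : (LinearMap.ker f).map (𝒱 (-1)).subtype = 𝒱 (-1) ⊓ (A ^ (m + 1)).ker := by
        rw [LinearMap.ker_comp, Submodule.map_comap_subtype]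
      have h1 := LinearMap.finrank_range_add_finrank_ker f
      rw [hrange, ← Submodule.finrank_map_subtype_eq (𝒱 (-1)) (LinearMap.ker f), hker] at h1
      have h2 := h𝒱.even_finrank (-1) (by decide)
      rw [← h1, Nat.even_add] at h2
      exact h2.1 (h𝒱.even_finrank _ ⟨m, rfl⟩)
    have hnondeg : ∀ u ∈ 𝒱 (-1) ⊓ (A ^ (m + 1)).ker,
        (∀ z ∈ 𝒱 (-1) ⊓ (A ^ (m + 1)).ker, η u z = 0) → u = 0 := by
      intro u hu hu'
      refine eq_zero_of_stabilizer_of_mem_neg_one hA hQ h𝒱 hη H heven (m := m)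
        (fun u hu hu' => ?_) hu hu'
      obtain ⟨x, hx, hxu⟩ := exists_pow_eq_of_mem_neg_one hA hQ h𝒱 hη (n := m) hu.1
        fun t ht ht' => by
          rw [← hneg] at ht
          obtain ⟨s, hs, rfl⟩ := ht
          rw [polarBilin_symm, ← hform s hs, form_swap hη.1, hu' s ⟨hs, ?_⟩, neg_zero]
          change (A ^ (m + 1)) s = 0
          rw [pow_succ, Module.End.mul_apply, ht']
      refine ⟨x, hx, hxu, ?_⟩
      have hu2 : (A ^ (m + 1)) u = 0 := hu.2
      rw [show 2 * m + 1 = (m + 1) + m by ring, pow_add, Module.End.mul_apply, hxu, hu2]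
    have hrestrict : ∀ x y : (𝒱 (-1) ⊓ (A ^ (m + 1)).ker : Submodule k V),
        LinearMap.BilinForm.restrict (LinearMap.BilinForm.compLeft Q.polarBilin A)
          (𝒱 (-1) ⊓ (A ^ (m + 1)).ker) x y = η (x : V) y := fun x y => by
      rw [hform x x.2.1]
      rfl
    constructor
    · intro x hx
      refine Subtype.ext (hnondeg x x.2 fun z hz => ?_)
      rw [← hrestrict x ⟨z, hz⟩, hx]
    · intro y hy
      refine Subtype.ext (hnondeg y y.2 fun z hz => ?_)
      rw [form_swap hη.1, ← hrestrict ⟨z, hz⟩ y, hy, neg_zero]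

end Necessity

end OddOrthogonal

end

theorem proposition3p1 {k : Type*} [Field k] [IsAlgClosed k]
    {V : Type*} [AddCommGroup V] [Module k V] [FiniteDimensional k V]
    (Q : QuadraticForm k V) (hQ : Q.Nondegenerate) (hV : Odd (Module.finrank k V))
    (𝒱 : ℤ → Submodule k V) [DirectSum.Decomposition 𝒱] (h𝒱 : OddOrthogonal.IsOGood Q 𝒱)
    (ξ : Module.Dual k (OddOrthogonal.orthLie Q)) :
    ξ ∈ OddOrthogonal.dualTwoShriek Q 𝒱 ↔
      OddOrthogonal.formOfDual Q ξ ∈ OddOrthogonal.formsTwoZero Q 𝒱 := by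
  constructor
  · rintro ⟨h1, h2⟩
    refine OddOrthogonal.mem_formsTwoZero_of_stabilizer hQ h𝒱
      ((OddOrthogonal.mem_dualGradedPiece_two_iff h𝒱 ξ).1 h1) fun g hg hgη => ?_
    exact h2 ((OddOrthogonal.mem_coadjointCentralizer_iff ξ ⟨g, hg⟩).2 hgη)
  · intro h
    refine ⟨(OddOrthogonal.mem_dualGradedPiece_two_iff h𝒱 ξ).2 h.1, fun g hg a => ?_⟩
    exact OddOrthogonal.map_filtration_eq_of_mem_formsTwoZero hQ hV h𝒱 h g.2.1
      ((OddOrthogonal.mem_coadjointCentralizer_iff ξ g).1 hg) a
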